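/- **Lemma 2.** *Model.* Let $M\ge 1$ be an integer and $\lambda,\eta,P_T,G,T_1,T_2>0$, $d_0\ge 1$, $r_o\ge 1$, $\alpha>2$ real numbers, and put $T=T_1+T_2$. A typical tag is located at the origin of $\mathbb{R}^2$; its own reader is at distance $d_0$ and starts to transmit at time $0$. The other readers, described by their locations and starting times $(x,t_x)$, form a homogeneous Poisson point process $\Phi$ on $\mathbb{R}^2\times\mathbb{R}$ of intensity $\lambda$. Independently of $\Phi$, every $(x,t_x)\in\Phi$ carries independent marks $\mathbf{h}_x,\mathbf{g}_x\sim\mathcal{CN}(\mathbf{0},\mathbf{I})$ in $\mathbb{C}^M$ (the Rayleigh fading vectors from reader $x$ to the typical tag and to its own tag, respectively) and a phase $\varphi_x$ uniform on $[-\pi,\pi)$; the marks of different readers are independent. A further phase $\varphi_0$ is uniform on $[-\pi,\pi)$ and independent of everything else. Let $\mathbf{w}_x=\mathbf{g}_x/\|\mathbf{g}_x\|$ be the maximal-ratio transmit (MRT) weight vector, $e(t,s)=\mathbb{1}(s\le t\le s+T)$ and $L(d)=\max\{d,r_o\}$. The signal received by the typical tag at time $t$ is $$y_T(t)=\sqrt{P_TGd_0^{-\alpha}}\,e^{j\varphi_0}+\sqrt{P_T}\sum_{(x,t_x)\in\Phi}e(t,t_x)\,\mathbf{h}_x^{\mathsf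 T}\mathbf{w}_x\,L(\|x\|)^{-\alpha/2}e^{j\varphi_x},$$ where $j$ is the imaginary unit and the sum over $\Phi$ is the limit, as $R\to\infty$, of the sums over the readers with $\|x\|\le R$. The harvested energy is $E_H=\eta\int_0^{T_1}|y_T(t)|^2\,dt$. *Claim.* For every $t\in[0,T_1]$ the limit that defines $y_T(t)$ exists almost surely; almost surely it exists for almost every $t\in[0,T_1]$ and $|y_T|^2$ is integrable on $[0,T_1]$; and $E_H$ is square-integrable with mean $$\mathbb{E}\{E_H\}=\eta P_TT_1\left(Gd_0^{-\alpha}+\pi\lambda T\frac{\alpha}{\alpha-2}r_o^{2-\alpha}\right)$$ and variance $$\mathbb{D}\{E_H\}=(\eta P_TT_1)^2\Bigg(\frac23(2T_1+3T_2)\pi\lambda\alpha r_o^{2-\alpha}\left(\frac{Gd_0^{-\alpha}}{\alpha-2}+\frac{r_o^{-\alpha}}{\alpha-1}\right)+\left(\pi\lambda\frac{\alpha}{\alpha-2}r_o^{2-\alpha}\right)^2\frac16\left(3T_1^2+8T_1T_2+6T_2^2\right)\Bigg).$$ -/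

import Mathlib

open MeasureTheory ProbabilityTheory Filter Topology

noncomputable section

/-- The plane `ℝ²` with its Euclidean distance. -/
abbrev Plane : Type := EuclideanSpace ℝ (Fin 2)

/-- The number of indices `n` for which the point `X n ω` lies in `B`. -/
def pointCount {Ω S : Type*} (X : ℕ → Ω → S) (B : Set S) (ω : Ω) : ℕ∞ :=
  Set.encard {n : ℕ | X n ω ∈ B}

/-- The random points `X 0, X 1, …` are an enumeration of a Poisson point process with (infinite)
intensity measure `ν`: the number of points in a set `B` of finite measure is Poisson with mean
`ν B`, and the numbers of points in disjoint sets are independent. -/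
structure IsPoissonPointProcess {Ω S : Type*} [MeasurableSpace Ω] [MeasurableSpace S]
    (X : ℕ → Ω → S) (ν : Measure S) (P : Measure Ω) : Prop where
  measurable : ∀ n, Measurable (X n)
  hasLaw_count : ∀ B : Set S, MeasurableSet B → ν B ≠ ⊤ →
    HasLaw (pointCount X B) ((poissonMeasure (ν B).toNNReal).map (fun k : ℕ => (k : ℕ∞))) P
  iIndep_count : ∀ (m : ℕ) (B : Fin m → Set S), (∀ i, MeasurableSet (B i)) →
    Pairwise (fun i j => Disjoint (B i) (B j)) → iIndepFun (fun i => pointCount X (B i)) P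

/-- The circular complex Gaussian law `CN(0, 1)`: real and imaginary parts are independent,
centred, and of variance `1/2`. -/
def complexGaussian : Measure ℂ :=
  ((gaussianReal 0 (1 / 2)).prod (gaussianReal 0 (1 / 2))).map
    (fun p : ℝ × ℝ => (p.1 : ℂ) + (p.2 : ℂ) * Complex.I)

/-- The law `CN(0, I)` on `ℂ^M`. -/
def complexGaussianVec (M : ℕ) : Measure (Fin M → ℂ) :=
  Measure.pi (fun _ => complexGaussian)

/-- The uniform law on `[-π, π)`. -/
def uniformPhase : Measure ℝ :=
  ProbabilityTheory.cond volume (Set.Ico (-Real.pi) Real.pi)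

/-- The maximal-ratio transmit weight vector `h / ‖h‖` (Euclidean norm) for the channel `h`. -/
def mrtWeight {M : ℕ} (h : Fin M → ℂ) : Fin M → ℂ :=
  fun i => h i / ((Real.sqrt (∑ k, ‖h k‖ ^ 2) : ℝ) : ℂ)

/-- The random elements seen by the typical tag, which is at the origin and whose own reader
starts at time `0`. The other readers are numbered by `ℕ`. -/
structure TagEnvironment (Ω : Type*) (M : ℕ) where
  /-- location and starting time `(x, t_x)` of the other readers -/
  reader : ℕ → Ω → Plane × ℝ
  /-- small-scale fading from each other reader to the typical tag -/
  crossChannel : ℕ → Ω → (Fin M → ℂ)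
  /-- small-scale fading from each other reader to its own tag, used for its beamforming -/
  ownChannel : ℕ → Ω → (Fin M → ℂ)
  /-- carrier phase of each other reader -/
  phase : ℕ → Ω → ℝ
  /-- phase of the carrier wave that the typical tag receives from its own reader -/
  tagPhase : Ω → ℝ

/-- The joint law: the other readers are a homogeneous time-space Poisson process of intensity `lam`;
they are independently marked with independent `CN(0, I)` channels and uniform
phases; the phase of the typical pair is uniform and independent of everything else. -/
structure TagEnvironment.IsModel {Ω : Type*} [MeasurableSpace Ω] {M : ℕ}
    (N : TagEnvironment Ω M) (lam : ℝ) (P : Measure Ω) : Prop where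
  poisson : IsPoissonPointProcess N.reader (ENNReal.ofReal lam • volume) P
  hasLaw_mark : ∀ n, HasLaw (fun ω => (N.crossChannel n ω, N.ownChannel n ω, N.phase n ω))
    ((complexGaussianVec M).prod ((complexGaussianVec M).prod uniformPhase)) P
  hasLaw_tagPhase : HasLaw N.tagPhase uniformPhase P
  iIndep_mark :
    iIndepFun (fun n ω => (N.crossChannel n ω, N.ownChannel n ω, N.phase n ω)) P
  indep_tagPhase : IndepFun N.tagPhase
    (fun ω n => (N.crossChannel n ω, N.ownChannel n ω, N.phase n ω)) P
  indep_reader : IndepFun (fun ω n => N.reader n ω)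
    (fun ω => (N.tagPhase ω,
      fun n => (N.crossChannel n ω, N.ownChannel n ω, N.phase n ω))) P

/-- The activity indicator `e(t, s) = 1(s ≤ t ≤ s + T)` of a reader that starts at time `s`. -/
def activity (T t s : ℝ) : ℂ :=
  Set.indicator (Set.Icc s (s + T)) (fun _ => (1 : ℂ)) t

/-- The contribution
`e(t, t_x) (h_x ⬝ w_x) L(d_x)^(-α/2) e^{j φ_x}`, with `L(d) = max d ro`, of the reader number `n`. -/
def TagEnvironment.contribution {Ω : Type*} {M : ℕ} (N : TagEnvironment Ω M)
    (T α ro t : ℝ) (n : ℕ) (ω : Ω) : ℂ :=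
  activity T t (N.reader n ω).2 *
    (N.crossChannel n ω ⬝ᵥ mrtWeight (N.ownChannel n ω)) *
    (((max ‖(N.reader n ω).1‖ ro) ^ (-α / 2) : ℝ) : ℂ) *
    Complex.exp ((N.phase n ω : ℂ) * Complex.I)

/-- The signal at the typical tag at time `t`, when, among the other readers, only those
within distance `R` are taken into account (almost surely finitely many of them are active). -/
def TagEnvironment.signalWithin {Ω : Type*} {M : ℕ} (N : TagEnvironment Ω M)
    (PT G d0 T α ro R t : ℝ) (ω : Ω) : ℂ :=
  ((Real.sqrt (PT * G * d0 ^ (-α)) : ℝ) : ℂ) * Complex.exp ((N.tagPhase ω : ℂ) * Complex.I) +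
    ((Real.sqrt PT : ℝ) : ℂ) *
      ∑' n, Set.indicator {m : ℕ | ‖(N.reader m ω).1‖ ≤ R} (fun m => N.contribution T α ro t m ω) n

/-- The signal `y_T(t)` at the typical tag. The sum over all readers is the limit of the sums over
the discs of radius `R → ∞`; for `α ≤ 4` it is not absolutely convergent. -/
def TagEnvironment.signal {Ω : Type*} {M : ℕ} (N : TagEnvironment Ω M)
    (PT G d0 T α ro t : ℝ) (ω : Ω) : ℂ :=
  limUnder atTop (fun R : ℝ => N.signalWithin PT G d0 T α ro R t ω)

/-- The harvested energy `E_H = η ∫_0^{T1} |y_T(t)|² dt`, for slots of duration `T = T1 + T2`. -/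
def TagEnvironment.harvestedEnergy {Ω : Type*} {M : ℕ} (N : TagEnvironment Ω M)
    (η PT G d0 T1 T2 α ro : ℝ) (ω : Ω) : ℝ :=
  η * ∫ t in (0 : ℝ)..T1, ‖N.signal PT G d0 (T1 + T2) α ro t ω‖ ^ 2

end

/-!
Given the locations and starting times of the readers, the signal is a random series
`∑ c n * Z n` in independent circular coefficients `Z n = (h ⬝ w) e^{jφ}`, plus the independent
phase factor of the tag's own reader. Conditionally on its own channel, the beamforming vector `w`
is a deterministic unit vector, so that `Z n` has the moments of `CN(0, 1)` up to order four
(`hasCircularMoments_coefficientLaw`), which is all that is needed.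

For `c n = e(t, t_x) L(‖x‖)^(-α/2)` the sum `∑ |c n|²` has a finite mean by Campbell's formula.
Hence it is almost surely finite, even uniformly for `t` in the time window (`HasFinitePower`),
although `∑ |c n|` need not be. Since only finitely many active readers lie in each disc, the partial
sums over discs are, in the order of increasing distance, an `L²`-bounded martingale. They converge
almost surely (`ae_exists_tendsto_tsum_indicator`), and also in `L⁴`
(`memLp_and_tendsto_eLpNorm_sum_sub`), which carries the second and fourth moments of finite sums
over to the limit. Let `c n` and `d n` be the amplitudes at two times `s` and `t`, and put
`U = ∑ (c n)²`, `V = ∑ (d n)²`, `W = ∑ c n d n` and `a² = G d0^(-α)`. Given the readers,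
the normalized power at time `s` has mean `U + a²`, and the product of the powers at both times has
mean `(U + a²)(V + a²) + W² + 2 a² W` (`HasFinitePower.lintegral_normalizedSignal`).

Campbell's formulas of first and second order (`IsPoissonPointProcess.lintegral_tsum_eq` and
`IsPoissonPointProcess.lintegral_tsum_mul_tsum`) average these over the readers. They are derived
from the counting variables: Poisson counts and independence give the formulas for indicators, and
measures that agree on sets of finite measure are equal. The covariance of the powers at `s` and `t`
becomes a quadratic polynomial in the overlap `T - |s - t|` of the activity windows
(`lintegral_signalPower_mul_signalPower`), and its integral over pairs of times
(`lintegral_lintegral_overlap`) gives the variance of the energy.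

The convergence statements for almost every time are obtained by exchanging the quantifiers over
times and outcomes. As the probability space need not make the signal jointly measurable, this is
done for the joint law of readers and coefficients on a space of sequences, where convergence along
rational radii is a measurable event; `HasFinitePower.exists_tendsto_real_of_rat` returns to real
radii.
-/

noncomputable section

/-! ### Circular complex random variables and their moments up to order four -/

/-- The moment conditions up to order four that a circularly symmetric complex law of unit power
satisfies: `E ζ = E ζ² = E |ζ|² ζ = 0`, `E |ζ|² = 1`, and `κ = E |ζ|⁴` is recorded as a parameter
(`κ = 2` for `CN(0, 1)`, `κ = 1` for a uniform point of the unit circle). -/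
structure HasCircularMoments (μ : Measure ℂ) (κ : ℝ) : Prop where
  memLp : MemLp (fun z : ℂ => z) 4 μ
  mean : ∫ z, z ∂μ = 0
  mean_sq : ∫ z, z ^ 2 ∂μ = 0
  mean_normSq_mul : ∫ z, ((‖z‖ ^ 2 : ℝ) : ℂ) * z ∂μ = 0
  mean_normSq : ∫ z, ‖z‖ ^ 2 ∂μ = 1
  mean_norm_four : ∫ z, ‖z‖ ^ 4 ∂μ = κ

/-- The expansion in the monomials of `z` whose means the structure `HasCircularMoments` records. -/
lemma norm_add_sq_mul_norm_add_sq (a b u v z : ℂ) :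
    ‖a + u * z‖ ^ 2 * ‖b + v * z‖ ^ 2 =
      ‖a‖ ^ 2 * ‖b‖ ^ 2 +
      ((2 * ‖b‖ ^ 2 * (starRingEnd ℂ a * u) + 2 * ‖a‖ ^ 2 * (starRingEnd ℂ b * v)) * z).re +
      (2 * starRingEnd ℂ a * starRingEnd ℂ b * u * v * z ^ 2).re +
      ((2 * ‖v‖ ^ 2 * (starRingEnd ℂ a * u) + 2 * ‖u‖ ^ 2 * (starRingEnd ℂ b * v)) *
        (((‖z‖ ^ 2 : ℝ) : ℂ) * z)).re +
      (‖a‖ ^ 2 * ‖v‖ ^ 2 + ‖b‖ ^ 2 * ‖u‖ ^ 2 +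
        2 * (a * starRingEnd ℂ b * starRingEnd ℂ u * v).re) * ‖z‖ ^ 2 +
      ‖u‖ ^ 2 * ‖v‖ ^ 2 * ‖z‖ ^ 4 := by
  have h4 : ‖z‖ ^ 4 = (‖z‖ ^ 2) ^ 2 := by ring
  have hs : ∀ w : ℂ, ‖w‖ ^ 2 = w.re * w.re + w.im * w.im := fun w => by
    rw [Complex.sq_norm, Complex.normSq_apply]
  rw [h4]
  simp only [← Complex.ofReal_pow]
  simp only [hs, Complex.mul_re, Complex.mul_im, Complex.add_re, Complex.add_im,
    Complex.conj_re, Complex.conj_im, Complex.ofReal_re, Complex.ofReal_im, pow_two,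
    Complex.re_ofNat, Complex.im_ofNat]
  ring

namespace HasCircularMoments

variable {μ : Measure ℂ} [IsProbabilityMeasure μ] {κ : ℝ}

lemma integrable_id (h : HasCircularMoments μ κ) : Integrable (fun z : ℂ => z) μ :=
  h.memLp.integrable (by norm_num)

lemma integrable_norm_pow (h : HasCircularMoments μ κ) {k : ℕ} (hk : k ≤ 4) :
    Integrable (fun z : ℂ => ‖z‖ ^ k) μ := by
  have := h.memLp.mono_exponent (p := (k : ENNReal)) (by exact_mod_cast hk)
  exact this.integrable_norm_pow'

lemma integrable_sq (h : HasCircularMoments μ κ) : Integrable (fun z : ℂ => z ^ 2) μ := by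
  refine (h.integrable_norm_pow (k := 2) (by norm_num)).mono' (by fun_prop) (.of_forall fun z => ?_)
  simp

lemma integrable_normSq_mul (h : HasCircularMoments μ κ) :
    Integrable (fun z : ℂ => ((‖z‖ ^ 2 : ℝ) : ℂ) * z) μ := by
  refine (h.integrable_norm_pow (k := 3) (by norm_num)).mono' (by fun_prop) (.of_forall fun z => ?_)
  simp
  exact le_of_eq (by ring)

lemma integral_norm_add_sq_mul (h : HasCircularMoments μ κ) (a b u v : ℂ) :
    ∫ z, ‖a + u * z‖ ^ 2 * ‖b + v * z‖ ^ 2 ∂μ =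
      ‖a‖ ^ 2 * ‖b‖ ^ 2 + ‖a‖ ^ 2 * ‖v‖ ^ 2 + ‖b‖ ^ 2 * ‖u‖ ^ 2 +
        2 * (a * starRingEnd ℂ b * starRingEnd ℂ u * v).re + κ * (‖u‖ ^ 2 * ‖v‖ ^ 2) := by
  have hre : ∀ (C : ℂ) (f : ℂ → ℂ), Integrable f μ → ∫ z, f z ∂μ = 0 →
      Integrable (fun z => (C * f z).re) μ ∧ ∫ z, (C * f z).re ∂μ = 0 := by
    intro C f hf h0
    refine ⟨(hf.const_mul C).re, ?_⟩
    have := integral_re (hf.const_mul C)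
    simp only [RCLike.re_to_complex] at this
    rw [this, integral_const_mul, h0]; simp
  simp_rw [norm_add_sq_mul_norm_add_sq]
  obtain ⟨i1, e1⟩ := hre (2 * ‖b‖ ^ 2 * (starRingEnd ℂ a * u) +
    2 * ‖a‖ ^ 2 * (starRingEnd ℂ b * v)) _ h.integrable_id h.mean
  obtain ⟨i2, e2⟩ := hre (2 * starRingEnd ℂ a * starRingEnd ℂ b * u * v) _ h.integrable_sq h.mean_sq
  obtain ⟨i3, e3⟩ := hre (2 * ‖v‖ ^ 2 * (starRingEnd ℂ a * u) +
    2 * ‖u‖ ^ 2 * (starRingEnd ℂ b * v)) _ h.integrable_normSq_mul h.mean_normSq_mul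
  have i4 := (h.integrable_norm_pow (k := 2) (by norm_num)).const_mul
    (‖a‖ ^ 2 * ‖v‖ ^ 2 + ‖b‖ ^ 2 * ‖u‖ ^ 2 + 2 * (a * starRingEnd ℂ b * starRingEnd ℂ u * v).re)
  have i5 := (h.integrable_norm_pow (k := 4) le_rfl).const_mul (‖u‖ ^ 2 * ‖v‖ ^ 2)
  have i0 : Integrable (fun _ : ℂ => ‖a‖ ^ 2 * ‖b‖ ^ 2) μ := integrable_const _
  rw [integral_add ((((i0.fun_add i1).fun_add i2).fun_add i3).fun_add i4) i5,
    integral_add (((i0.fun_add i1).fun_add i2).fun_add i3) i4,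
    integral_add ((i0.fun_add i1).fun_add i2) i3, integral_add (i0.fun_add i1) i2,
    integral_add i0 i1, e1, e2, e3, integral_const,
    integral_const_mul, integral_const_mul, h.mean_normSq, h.mean_norm_four]
  simp
  ring

lemma integral_add_mul_conj_add (h : HasCircularMoments μ κ) (a b u v : ℂ) :
    ∫ z, (a + u * z) * starRingEnd ℂ (b + v * z) ∂μ =
      a * starRingEnd ℂ b + u * starRingEnd ℂ v := by
  have e : ∀ z : ℂ, (a + u * z) * starRingEnd ℂ (b + v * z) =
      a * starRingEnd ℂ b + u * starRingEnd ℂ b * z + a * starRingEnd ℂ v * starRingEnd ℂ z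
        + u * starRingEnd ℂ v * ((‖z‖ ^ 2 : ℝ) : ℂ) := by
    intro z
    rw [Complex.ofReal_pow, ← Complex.mul_conj']
    simp only [map_add, map_mul]; ring
  simp_rw [e]
  have i0 : Integrable (fun _ : ℂ => a * starRingEnd ℂ b) μ := integrable_const _
  have i1 := h.integrable_id.const_mul (u * starRingEnd ℂ b)
  have i2' : Integrable (fun z : ℂ => starRingEnd ℂ z) μ :=
    (Complex.conjLIE.toContinuousLinearEquiv : ℂ →L[ℝ] ℂ).integrable_comp h.integrable_id
  have i2 := i2'.const_mul (a * starRingEnd ℂ v)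
  have i3 : Integrable (fun z : ℂ => u * starRingEnd ℂ v * ((‖z‖ ^ 2 : ℝ) : ℂ)) μ :=
    (h.integrable_norm_pow (k := 2) (by norm_num)).ofReal.const_mul _
  rw [integral_add ((i0.fun_add i1).fun_add i2) i3, integral_add (i0.fun_add i1) i2,
    integral_add i0 i1, integral_const, integral_const_mul, integral_const_mul,
    integral_const_mul, h.mean, integral_conj, h.mean,
    integral_complex_ofReal, h.mean_normSq]
  simp

end HasCircularMoments

section FiniteSums

variable {Ω : Type*} [MeasurableSpace Ω] {Q : Measure Ω}

lemma HasCircularMoments.memLp_of_hasLaw {μ : Measure ℂ} {κ : ℝ} (hμ : HasCircularMoments μ κ)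
    {ζ : Ω → ℂ} (hζ : HasLaw ζ μ Q) : MemLp ζ 4 Q := by
  have := hμ.memLp
  rw [← hζ.map_eq] at this
  exact this.comp_of_map hζ.aemeasurable

lemma memLp_norm_sq {A : Ω → ℂ} (hA : MemLp A 4 Q) : MemLp (fun ω => ‖A ω‖ ^ 2) 2 Q := by
  have := hA.norm_rpow_div 2
  norm_num at this
  convert this using 2
  rw [ENNReal.eq_div_iff (by norm_num) (by norm_num)]; norm_num

lemma integrable_normSq_mul_normSq {A B : Ω → ℂ} (hA : MemLp A 4 Q) (hB : MemLp B 4 Q) :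
    Integrable (fun ω => ‖A ω‖ ^ 2 * ‖B ω‖ ^ 2) Q :=
  (memLp_norm_sq hA).integrable_mul (q := 2) (memLp_norm_sq hB)

lemma ofReal_integral_norm_sq {A : Ω → ℂ} :
    ((∫ ω, ‖A ω‖ ^ 2 ∂Q : ℝ) : ℂ) = ∫ ω, A ω * starRingEnd ℂ (A ω) ∂Q := by
  rw [← integral_complex_ofReal]
  congr with ω
  rw [Complex.mul_conj', Complex.ofReal_pow]

variable {ι : Type*} {Z : ι → Ω → ℂ} {μ : Measure ℂ}

lemma memLp_sum_mul {κ : ℝ} (hμ : HasCircularMoments μ κ) (hZ : ∀ n, HasLaw (Z n) μ Q)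
    (F : Finset ι) (c : ι → ℂ) : MemLp (fun ω => ∑ n ∈ F, c n * Z n ω) 4 Q :=
  memLp_finsetSum F fun n _ => (hμ.memLp_of_hasLaw (hZ n)).const_mul (c n)

lemma indepFun_sum_sum [DecidableEq ι] (hm : ∀ n, Measurable (Z n)) (hind : iIndepFun Z Q)
    (c d : ι → ℂ) {F : Finset ι} {n : ι} (hn : n ∉ F) :
    IndepFun (fun ω => (∑ m ∈ F, c m * Z m ω, ∑ m ∈ F, d m * Z m ω)) (Z n) Q := by
  have h := hind.indepFun_finset F {n} (by simpa using hn) hm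
  have hφ : Measurable (fun z : F → ℂ => (∑ m : F, c m * z m, ∑ m : F, d m * z m)) := by fun_prop
  have hψ : Measurable (fun z : ({n} : Finset ι) → ℂ => z ⟨n, by simp⟩) := measurable_pi_apply _
  have h2 := h.comp hφ hψ
  convert h2 using 1
  · ext ω
    · simp [← Finset.sum_coe_sort F (fun m => c m * Z m ω)]
    · simp [← Finset.sum_coe_sort F (fun m => d m * Z m ω)]
  · rfl

variable [IsProbabilityMeasure Q]

lemma integrable_mul_conj {A B : Ω → ℂ} (hA : MemLp A 4 Q) (hB : MemLp B 4 Q) :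
    Integrable (fun ω => A ω * starRingEnd ℂ (B ω)) Q := by
  have h2A := hA.mono_exponent (p := 2) (by norm_num)
  have h2B := hB.mono_exponent (p := 2) (by norm_num)
  exact h2A.integrable_mul (q := 2) h2B.star

/-- Fubini's theorem: a variable that is independent of the pair `(A, B)` is integrated out first. -/
lemma integral_indep_pair {μ : Measure ℂ} [IsProbabilityMeasure μ] {A B ζ : Ω → ℂ}
    (hA : AEMeasurable A Q) (hB : AEMeasurable B Q) (hζ : HasLaw ζ μ Q)
    (hind : IndepFun (fun ω => (A ω, B ω)) ζ Q)
    {E : Type*} [NormedAddCommGroup E] [NormedSpace ℝ E] [CompleteSpace E]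
    {F : (ℂ × ℂ) × ℂ → E} (hF : StronglyMeasurable F)
    (hint : Integrable (fun ω => F ((A ω, B ω), ζ ω)) Q) :
    ∫ ω, F ((A ω, B ω), ζ ω) ∂Q = ∫ ω, ∫ z, F ((A ω, B ω), z) ∂μ ∂Q := by
  have hAB : AEMeasurable (fun ω => (A ω, B ω)) Q := hA.prodMk hB
  have hmap := (indepFun_iff_map_prod_eq_prod_map_map hAB hζ.aemeasurable).1 hind
  rw [hζ.map_eq] at hmap
  have hP : IsProbabilityMeasure (Q.map (fun ω => (A ω, B ω))) :=
    Measure.isProbabilityMeasure_map hAB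
  have h1 : ∫ ω, F ((A ω, B ω), ζ ω) ∂Q =
      ∫ p, F p ∂(Q.map (fun ω => ((A ω, B ω), ζ ω))) :=
    (integral_map (hAB.prodMk hζ.aemeasurable) hF.aestronglyMeasurable).symm
  have h2 : Integrable F (Q.map (fun ω => ((A ω, B ω), ζ ω))) :=
    (integrable_map_measure hF.aestronglyMeasurable (hAB.prodMk hζ.aemeasurable)).2 hint
  rw [h1, hmap, integral_prod _ (hmap ▸ h2)]
  exact integral_map hAB hF.integral_prod_right'.aestronglyMeasurable

lemma integral_add_mul_conj_add_of_indep {μ : Measure ℂ} [IsProbabilityMeasure μ] {κ : ℝ}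
    (hμ : HasCircularMoments μ κ) {A B ζ : Ω → ℂ} (hA : MemLp A 4 Q) (hB : MemLp B 4 Q)
    (hζ : HasLaw ζ μ Q) (hind : IndepFun (fun ω => (A ω, B ω)) ζ Q) (u v : ℂ) :
    ∫ ω, (A ω + u * ζ ω) * starRingEnd ℂ (B ω + v * ζ ω) ∂Q =
      (∫ ω, A ω * starRingEnd ℂ (B ω) ∂Q) + u * starRingEnd ℂ v := by
  have hm := hμ.memLp_of_hasLaw hζ
  have := integral_indep_pair hA.1.aemeasurable hB.1.aemeasurable hζ hind
    (F := fun p => (p.1.1 + u * p.2) * starRingEnd ℂ (p.1.2 + v * p.2)) (by fun_prop)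
    (integrable_mul_conj (hA.add (hm.const_mul u)) (hB.add (hm.const_mul v)))
  simp only [hμ.integral_add_mul_conj_add] at this
  rw [this, integral_add (integrable_mul_conj hA hB) (integrable_const _)]
  simp

lemma integral_norm_add_sq_mul_of_indep {μ : Measure ℂ} [IsProbabilityMeasure μ] {κ : ℝ}
    (hμ : HasCircularMoments μ κ) {A B ζ : Ω → ℂ} (hA : MemLp A 4 Q) (hB : MemLp B 4 Q)
    (hζ : HasLaw ζ μ Q) (hind : IndepFun (fun ω => (A ω, B ω)) ζ Q) (u v : ℂ) :
    ∫ ω, ‖A ω + u * ζ ω‖ ^ 2 * ‖B ω + v * ζ ω‖ ^ 2 ∂Q =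
      (∫ ω, ‖A ω‖ ^ 2 * ‖B ω‖ ^ 2 ∂Q) + (∫ ω, ‖A ω‖ ^ 2 ∂Q) * ‖v‖ ^ 2 +
        (∫ ω, ‖B ω‖ ^ 2 ∂Q) * ‖u‖ ^ 2 +
        2 * ((∫ ω, A ω * starRingEnd ℂ (B ω) ∂Q) * (starRingEnd ℂ u * v)).re +
        κ * (‖u‖ ^ 2 * ‖v‖ ^ 2) := by
  have hm := hμ.memLp_of_hasLaw hζ
  have := integral_indep_pair hA.1.aemeasurable hB.1.aemeasurable hζ hind
    (F := fun p => ‖p.1.1 + u * p.2‖ ^ 2 * ‖p.1.2 + v * p.2‖ ^ 2)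
    (Measurable.stronglyMeasurable (by fun_prop))
    (integrable_normSq_mul_normSq (hA.add (hm.const_mul u)) (hB.add (hm.const_mul v)))
  simp only [hμ.integral_norm_add_sq_mul] at this
  have i0 := integrable_normSq_mul_normSq hA hB
  have i1 := ((memLp_norm_sq hA).integrable (by norm_num)).mul_const (‖v‖ ^ 2)
  have i2 := ((memLp_norm_sq hB).integrable (by norm_num)).mul_const (‖u‖ ^ 2)
  have i3' := (integrable_mul_conj hA hB).mul_const (starRingEnd ℂ u * v)
  have i3 := i3'.re.const_mul 2
  have e3 : ∫ ω, (A ω * starRingEnd ℂ (B ω) * (starRingEnd ℂ u * v)).re ∂Q =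
      ((∫ ω, A ω * starRingEnd ℂ (B ω) ∂Q) * (starRingEnd ℂ u * v)).re := by
    have := integral_re i3'
    simp only [RCLike.re_to_complex] at this
    rw [this, integral_mul_const]
  simp only [RCLike.re_to_complex] at i3
  simp only [mul_assoc _ (starRingEnd ℂ u) v] at this
  rw [this, integral_add (((i0.fun_add i1).fun_add i2).fun_add i3) (integrable_const _),
    integral_add ((i0.fun_add i1).fun_add i2) i3, integral_add (i0.fun_add i1) i2,
    integral_add i0 i1, integral_mul_const, integral_mul_const, integral_const_mul, e3]
  simp

variable [IsProbabilityMeasure μ]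

lemma integral_sum_mul_conj_sum {κ : ℝ} (hμ : HasCircularMoments μ κ)
    (hm : ∀ n, Measurable (Z n)) (hZ : ∀ n, HasLaw (Z n) μ Q) (hind : iIndepFun Z Q)
    (F : Finset ι) (c d : ι → ℂ) :
    ∫ ω, (∑ n ∈ F, c n * Z n ω) * starRingEnd ℂ (∑ n ∈ F, d n * Z n ω) ∂Q =
      ∑ n ∈ F, c n * starRingEnd ℂ (d n) := by
  classical
  induction F using Finset.induction_on with
  | empty => simp
  | insert n F hn ih =>
    simp_rw [Finset.sum_insert hn, add_comm (c n * _), add_comm (d n * _)]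
    rw [integral_add_mul_conj_add_of_indep hμ (memLp_sum_mul hμ hZ F c) (memLp_sum_mul hμ hZ F d)
      (hZ n) (indepFun_sum_sum hm hind c d hn), ih, add_comm]

lemma integral_norm_sq_sum {κ : ℝ} (hμ : HasCircularMoments μ κ)
    (hm : ∀ n, Measurable (Z n)) (hZ : ∀ n, HasLaw (Z n) μ Q) (hind : iIndepFun Z Q)
    (F : Finset ι) (c : ι → ℂ) :
    ∫ ω, ‖∑ n ∈ F, c n * Z n ω‖ ^ 2 ∂Q = ∑ n ∈ F, ‖c n‖ ^ 2 := by
  have h := ofReal_integral_norm_sq (Q := Q) (A := fun ω => ∑ n ∈ F, c n * Z n ω)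
  rw [integral_sum_mul_conj_sum hμ hm hZ hind] at h
  apply Complex.ofReal_injective
  rw [h]
  push_cast
  exact Finset.sum_congr rfl fun n _ => Complex.mul_conj' _

/-- The fourth-moment identity of complex Gaussian calculus. It needs only `κ = 2`: a general `κ`
would contribute the additional term `(κ - 2) ∑ |c|² |d|²`. -/
lemma integral_norm_sq_sum_mul_norm_sq_sum (hμ : HasCircularMoments μ 2)
    (hm : ∀ n, Measurable (Z n)) (hZ : ∀ n, HasLaw (Z n) μ Q) (hind : iIndepFun Z Q)
    (F : Finset ι) (c d : ι → ℂ) :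
    ∫ ω, ‖∑ n ∈ F, c n * Z n ω‖ ^ 2 * ‖∑ n ∈ F, d n * Z n ω‖ ^ 2 ∂Q =
      (∑ n ∈ F, ‖c n‖ ^ 2) * (∑ n ∈ F, ‖d n‖ ^ 2) + ‖∑ n ∈ F, c n * starRingEnd ℂ (d n)‖ ^ 2 := by
  classical
  induction F using Finset.induction_on with
  | empty => simp
  | insert n F hn ih =>
    simp_rw [Finset.sum_insert hn, add_comm (c n * _), add_comm (d n * _)]
    rw [integral_norm_add_sq_mul_of_indep hμ (memLp_sum_mul hμ hZ F c) (memLp_sum_mul hμ hZ F d)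
      (hZ n) (indepFun_sum_sum hm hind c d hn), ih, integral_norm_sq_sum hμ hm hZ hind,
      integral_norm_sq_sum hμ hm hZ hind, integral_sum_mul_conj_sum hμ hm hZ hind]
    generalize ∑ x ∈ F, c x * starRingEnd ℂ (d x) = w
    have hs : ∀ w : ℂ, ‖w‖ ^ 2 = w.re * w.re + w.im * w.im := fun w => by
      rw [Complex.sq_norm, Complex.normSq_apply]
    simp only [hs, Complex.mul_re, Complex.mul_im, Complex.add_re, Complex.add_im,
      Complex.conj_re, Complex.conj_im]
    ring

end FiniteSums

/-! ### Almost sure convergence of random series summed in the order of the distance -/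

section Convergence

variable {Ω : Type*} [mΩ : MeasurableSpace Ω] {Q : Measure Ω} [IsProbabilityMeasure Q]

/-- An `L²`-bounded sequence of partial sums of independent centred variables, taken over an
increasing sequence of finite index sets, is a martingale and converges almost surely. -/
lemma ae_exists_tendsto_sum_finset {V : ℕ → Ω → ℝ} (hm : ∀ n, Measurable (V n))
    (hL : ∀ n, MemLp (V n) 2 Q) (h0 : ∀ n, ∫ ω, V n ω ∂Q = 0) (hind : iIndepFun V Q)
    {F : ℕ → Finset ℕ} (hF : Monotone F) {C : ℝ}
    (hC : ∀ k, ∫ ω, (∑ n ∈ F k, V n ω) ^ 2 ∂Q ≤ C) :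
    ∀ᵐ ω ∂Q, ∃ l, Tendsto (fun k => ∑ n ∈ F k, V n ω) atTop (𝓝 l) := by
  let ℱ : Filtration ℕ mΩ :=
    { seq := fun k => ⨆ n ∈ (F k : Set ℕ), MeasurableSpace.comap (V n) inferInstance
      mono' := fun i j hij => biSup_mono fun n hn => hF hij hn
      le' := fun k => iSup₂_le fun n _ => (hm n).comap_le }
  have hadV : ∀ k, ∀ n ∈ F k, StronglyMeasurable[ℱ k] (V n) := fun k n hn =>
    ((comap_measurable (V n)).mono (le_iSup₂_of_le n (by simpa using hn) le_rfl)
      le_rfl).stronglyMeasurable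
  have hLs : ∀ G : Finset ℕ, MemLp (fun ω => ∑ n ∈ G, V n ω) 2 Q := fun G =>
    memLp_finsetSum G fun n _ => hL n
  have hint : ∀ G : Finset ℕ, Integrable (fun ω => ∑ n ∈ G, V n ω) Q := fun G =>
    (hLs G).integrable (by norm_num)
  have hmart : Martingale (fun k ω => ∑ n ∈ F k, V n ω) ℱ Q := by
    refine martingale_nat (fun k => Finset.stronglyMeasurable_fun_sum _ (hadV k))
      (fun k => hint _) fun k => ?_
    have hsplit : (fun ω => ∑ n ∈ F (k + 1), V n ω) =
        (fun ω => ∑ n ∈ F k, V n ω) + fun ω => ∑ n ∈ F (k + 1) \ F k, V n ω := by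
      ext ω
      simp only [Pi.add_apply]
      exact (add_comm _ _).trans (Finset.sum_sdiff (hF (Nat.le_succ k))) |>.symm
    rw [hsplit]
    have h1 : Q[fun ω => ∑ n ∈ F k, V n ω | ℱ k] = fun ω => ∑ n ∈ F k, V n ω :=
      condExp_of_stronglyMeasurable (ℱ.le k)
        (Finset.stronglyMeasurable_fun_sum _ (hadV k)) (hint _)
    have h2 : Q[fun ω => ∑ n ∈ F (k + 1) \ F k, V n ω | ℱ k] =ᵐ[Q] fun _ => 0 := by
      have hi := indep_iSup_of_disjoint (fun n => (hm n).comap_le) hind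
        (S := ((F (k + 1) \ F k : Finset ℕ) : Set ℕ)) (T := (F k : Set ℕ))
        (by rw [Finset.disjoint_coe]; exact Finset.sdiff_disjoint)
      have := condExp_indep_eq (μ := Q) (f := fun ω => ∑ n ∈ F (k + 1) \ F k, V n ω)
        (iSup₂_le fun n _ => (hm n).comap_le) (ℱ.le k)
        (Finset.stronglyMeasurable_fun_sum _ fun n hn =>
          ((comap_measurable (V n)).mono (le_iSup₂_of_le n (by simpa using hn) le_rfl)
            le_rfl).stronglyMeasurable) hi
      refine this.trans (.of_forall fun ω => ?_)
      simp only
      rw [integral_finsetSum _ fun n _ => (hL n).integrable (by norm_num)]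
      simp [h0]
    have h3 := condExp_add (hint (F k)) (hint (F (k + 1) \ F k)) (ℱ k)
    filter_upwards [h2, h3] with ω h2 h3
    rw [h3]
    simp only [Pi.add_apply, h2, h1, add_zero]
  refine hmart.submartingale.exists_ae_tendsto_of_bdd (R := (1 + C).toNNReal) fun k => ?_
  rw [eLpNorm_one_eq_lintegral_enorm, ← ofReal_integral_norm_eq_lintegral_enorm (hint _)]
  refine ENNReal.ofReal_le_ofReal ?_
  calc ∫ ω, ‖∑ n ∈ F k, V n ω‖ ∂Q ≤ ∫ ω, (1 + (∑ n ∈ F k, V n ω) ^ 2) ∂Q := by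
        refine integral_mono (hint _).norm ((integrable_const _).add (hLs _).integrable_sq)
          fun ω => ?_
        simp only [Real.norm_eq_abs]
        nlinarith [sq_nonneg (|∑ n ∈ F k, V n ω| - 1), sq_abs (∑ n ∈ F k, V n ω),
          abs_nonneg (∑ n ∈ F k, V n ω)]
    _ ≤ 1 + C := by
        rw [integral_add (integrable_const _) (hLs _).integrable_sq]
        simpa using hC k

/-- A set of indices in which every sublevel set of `r` is finite is exhausted by an increasing
sequence of finite sets, among which all the sublevel sets occur. (The `k`-th set consists of the
indices with fewer than `k` indices strictly before them.) -/
lemma exists_monotone_finset_sublevel (A : Set ℕ) (r : ℕ → ℝ)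
    (hfin : ∀ R : ℝ, {n | n ∈ A ∧ r n ≤ R}.Finite) :
    ∃ F : ℕ → Finset ℕ, Monotone F ∧ ∃ N : ℝ → ℕ, Monotone N ∧
      ∀ R, F (N R) = (hfin R).toFinset := by
  have hlt : ∀ R : ℝ, {n | n ∈ A ∧ r n < R}.Finite := fun R =>
    (hfin R).subset fun n hn => ⟨hn.1, hn.2.le⟩
  let rank : ℕ → ℕ := fun n => {m | m ∈ A ∧ r m < r n}.ncard
  have hk : ∀ k, {n | n ∈ A ∧ rank n < k}.Finite := by
    intro k
    by_contra hinf
    -- among infinitely many such indices, some lies strictly beyond `k` others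
    obtain ⟨s, hs, hsk⟩ := Set.Infinite.exists_subset_card_eq hinf k
    obtain ⟨R, hR⟩ := (s.image r).bddAbove
    obtain ⟨n, hn, hnR⟩ := Set.Infinite.exists_notMem_finite hinf (hfin R)
    have hRn : R < r n := by
      by_contra h
      exact hnR ⟨hn.1, not_lt.1 h⟩
    have : s.card ≤ rank n := by
      rw [← Set.ncard_coe_finset]
      refine Set.ncard_le_ncard (fun m hm => ⟨(hs hm).1, lt_of_le_of_lt (hR ?_) hRn⟩) (hlt _)
      simpa using ⟨m, hm, rfl⟩
    have := hn.2
    omega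
  refine ⟨fun k => (hk k).toFinset, fun i j hij => ?_, fun R => {n | n ∈ A ∧ r n ≤ R}.ncard,
    fun R R' h => ?_, fun R => ?_⟩
  · simp only [Set.Finite.toFinset_subset_toFinset]
    exact fun n hn => ⟨hn.1, hn.2.trans_le hij⟩
  · exact Set.ncard_le_ncard (fun n hn => ⟨hn.1, hn.2.trans h⟩) (hfin R')
  · ext n
    simp only [Set.Finite.mem_toFinset, Set.mem_ofPred_eq]
    refine and_congr_right fun hn => ⟨fun h => ?_, fun h => ?_⟩
    · by_contra hR
      refine absurd h (not_lt.2 (Set.ncard_le_ncard (fun m hm => ⟨hm.1, ?_⟩) (hlt _)))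
      exact lt_of_le_of_lt hm.2 (not_le.1 hR)
    · refine Set.ncard_lt_ncard ⟨fun m hm => ⟨hm.1, hm.2.le.trans h⟩, fun hsub => ?_⟩ (hfin R)
      exact lt_irrefl _ (hsub (show n ∈ {m | m ∈ A ∧ r m ≤ R} from ⟨hn, h⟩)).2

/-- Either `N` is bounded, hence eventually constant, or it tends to infinity. -/
lemma exists_tendsto_comp_monotone {E : Type*} [TopologicalSpace E] {U : ℕ → E} {l : E}
    (hU : Tendsto U atTop (𝓝 l)) {N : ℝ → ℕ} (hN : Monotone N) :
    ∃ l', Tendsto (fun R => U (N R)) atTop (𝓝 l') := by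
  by_cases hb : ∃ b, ∀ R, N R ≤ b
  · obtain ⟨b, hb⟩ := hb
    have hfin : (Set.range N).Finite := (Set.finite_Iic b).subset (by rintro _ ⟨R, rfl⟩; exact hb R)
    obtain ⟨m, ⟨R₀, hR₀⟩, hmax⟩ := hfin.exists_maximal (Set.range_nonempty N)
    refine ⟨U m, tendsto_const_nhds.congr' ?_⟩
    filter_upwards [eventually_ge_atTop R₀] with R hR
    have h1 : m ≤ N R := hR₀ ▸ hN hR
    rw [le_antisymm h1 (hmax ⟨R, rfl⟩ h1)]
  · push Not at hb
    refine ⟨l, hU.comp (tendsto_atTop_atTop_of_monotone hN fun b => ?_)⟩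
    obtain ⟨R, hR⟩ := hb b
    exact ⟨R, hR.le⟩

lemma tsum_indicator_eq_sum {A : Set ℕ} {r : ℕ → ℝ} {R : ℝ} (hfin : {n | n ∈ A ∧ r n ≤ R}.Finite)
    {f : ℕ → ℂ} (hf : ∀ n, n ∉ A → f n = 0) :
    ∑' n, Set.indicator {m | r m ≤ R} f n = ∑ n ∈ hfin.toFinset, f n := by
  rw [tsum_eq_sum (s := hfin.toFinset)]
  · refine Finset.sum_congr rfl fun n hn => ?_
    simp only [Set.Finite.mem_toFinset, Set.mem_ofPred_eq] at hn
    exact Set.indicator_of_mem (s := {m | r m ≤ R}) hn.2 f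
  · intro n hn
    simp only [Set.Finite.mem_toFinset, Set.mem_ofPred_eq, not_and, not_le] at hn
    by_cases hA : n ∈ A
    · exact Set.indicator_of_notMem (s := {m | r m ≤ R}) (not_le.2 (hn hA)) f
    · simp [Set.indicator, hf n hA]

variable {Z : ℕ → Ω → ℂ} {μ : Measure ℂ} [IsProbabilityMeasure μ]

lemma ae_exists_tendsto_sum_mul {κ : ℝ} (hμ : HasCircularMoments μ κ)
    (hm : ∀ n, Measurable (Z n)) (hZ : ∀ n, HasLaw (Z n) μ Q) (hind : iIndepFun Z Q)
    {c : ℕ → ℂ} (hc : Summable fun n => ‖c n‖ ^ 2) {F : ℕ → Finset ℕ} (hF : Monotone F) :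
    ∀ᵐ ω ∂Q, ∃ l, Tendsto (fun k => ∑ n ∈ F k, c n * Z n ω) atTop (𝓝 l) := by
  have hL4 : ∀ n, MemLp (fun ω => c n * Z n ω) 4 Q := fun n =>
    (hμ.memLp_of_hasLaw (hZ n)).const_mul (c n)
  have h0 : ∀ n, ∫ ω, c n * Z n ω ∂Q = 0 := fun n => by
    have : ∫ ω, Z n ω ∂Q = ∫ z, z ∂μ := (hZ n).integral_eq
    rw [integral_const_mul, this, hμ.mean, mul_zero]
  -- the real and the imaginary parts are treated alike, through a contractive linear functional
  have key : ∀ T : ℂ →L[ℝ] ℝ, (∀ z, |T z| ≤ ‖z‖) →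
      ∀ᵐ ω ∂Q, ∃ l, Tendsto (fun k => T (∑ n ∈ F k, c n * Z n ω)) atTop (𝓝 l) := by
    intro T hT
    have := ae_exists_tendsto_sum_finset (Q := Q) (V := fun n ω => T (c n * Z n ω))
      (fun n => T.measurable.comp ((hm n).const_mul _))
      (fun n => ((hL4 n).mono_exponent (p := 2) (by norm_num)).continuousLinearMap_comp T)
      (fun n => by
        rw [T.integral_comp_comm ((hL4 n).integrable (by norm_num)), h0, map_zero])
      (hind.comp (fun n z => T (c n * z)) fun n => T.measurable.comp (measurable_id.const_mul _))
      hF (C := ∑' n, ‖c n‖ ^ 2) fun k => ?_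
    · simpa only [map_sum] using this
    · simp only [← map_sum]
      calc ∫ ω, (T (∑ n ∈ F k, c n * Z n ω)) ^ 2 ∂Q
          ≤ ∫ ω, ‖∑ n ∈ F k, c n * Z n ω‖ ^ 2 ∂Q := by
            have hs := (memLp_sum_mul hμ hZ (F k) c).mono_exponent (p := 2) (by norm_num)
            refine integral_mono (hs.continuousLinearMap_comp T).integrable_sq
              (memLp_norm_sq (memLp_sum_mul hμ hZ (F k) c) |>.integrable (by norm_num))
              fun ω => ?_
            simp only
            rw [← sq_abs (T _)]
            gcongr
            exact hT _
        _ ≤ ∑' n, ‖c n‖ ^ 2 := by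
            rw [integral_norm_sq_sum hμ hm hZ hind]
            exact hc.sum_le_tsum _ fun n _ => by positivity
  filter_upwards [key Complex.reCLM fun z => Complex.abs_re_le_norm z,
    key Complex.imCLM fun z => Complex.abs_im_le_norm z] with ω ⟨l, hl⟩ ⟨l', hl'⟩
  refine ⟨(l : ℂ) + (l' : ℂ) * Complex.I, ?_⟩
  refine (((Complex.continuous_ofReal.tendsto l).comp hl).add
    (((Complex.continuous_ofReal.tendsto l').comp hl').mul_const Complex.I)).congr fun k => ?_
  exact Complex.re_add_im _

/-- A random series with square-summable coefficients converges almost surely when it is summed in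
the order of increasing `r`, whatever the ties. -/
lemma ae_exists_tendsto_tsum_indicator {κ : ℝ} (hμ : HasCircularMoments μ κ)
    (hm : ∀ n, Measurable (Z n)) (hZ : ∀ n, HasLaw (Z n) μ Q) (hind : iIndepFun Z Q)
    {c : ℕ → ℂ} (hc : Summable fun n => ‖c n‖ ^ 2) {r : ℕ → ℝ}
    (hfin : ∀ R : ℝ, {n | n ∈ {n | c n ≠ 0} ∧ r n ≤ R}.Finite) :
    ∀ᵐ ω ∂Q, ∃ l, Tendsto
      (fun R : ℝ => ∑' n, Set.indicator {m | r m ≤ R} (fun m => c m * Z m ω) n) atTop (𝓝 l) := by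
  obtain ⟨F, hF, N, hN, hFN⟩ := exists_monotone_finset_sublevel {n | c n ≠ 0} r hfin
  filter_upwards [ae_exists_tendsto_sum_mul hμ hm hZ hind hc hF] with ω ⟨l, hl⟩
  obtain ⟨l', hl'⟩ := exists_tendsto_comp_monotone hl hN
  refine ⟨l', hl'.congr fun R => ?_⟩
  rw [tsum_indicator_eq_sum (hfin R) (by simp +contextual), hFN]

end Convergence

/-! ### Moments of the limit -/

section LimitMoments

variable {Ω : Type*} [MeasurableSpace Ω] {Q : Measure Ω}

/-- By Hölder's inequality, products of convergent sequences converge in the product exponent. -/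
lemma tendsto_eLpNorm_mul_sub {p q r : ENNReal} [ENNReal.HolderTriple p q r] (hr : 1 ≤ r)
    {a b : ℕ → Ω → ℝ} {a' b' : Ω → ℝ} (ha : ∀ k, MemLp (a k) p Q) (hb : ∀ k, MemLp (b k) q Q)
    (ha' : MemLp a' p Q) (hb' : MemLp b' q Q) (hq : 1 ≤ q)
    (hla : Tendsto (fun k => eLpNorm (a k - a') p Q) atTop (𝓝 0))
    (hlb : Tendsto (fun k => eLpNorm (b k - b') q Q) atTop (𝓝 0)) :
    Tendsto (fun k => eLpNorm (a k * b k - a' * b') r Q) atTop (𝓝 0) := by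
  have hbound : ∀ k, eLpNorm (a k * b k - a' * b') r Q ≤
      eLpNorm (a k - a') p Q * (eLpNorm (b k - b') q Q + eLpNorm b' q Q) +
        eLpNorm a' p Q * eLpNorm (b k - b') q Q := by
    intro k
    have e : a k * b k - a' * b' = (a k - a') • b k + a' • (b k - b') := by
      simp only [smul_eq_mul]; ring
    have h1 := eLpNorm_smul_le_mul_eLpNorm (p := p) (q := q) (r := r) (hb k).1 ((ha k).sub ha').1
    have h2 := eLpNorm_smul_le_mul_eLpNorm (p := p) (q := q) (r := r) ((hb k).sub hb').1 ha'.1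
    have h3 : eLpNorm (b k) q Q ≤ eLpNorm (b k - b') q Q + eLpNorm b' q Q := by
      have := eLpNorm_add_le ((hb k).sub hb').1 hb'.1 hq
      rwa [sub_add_cancel] at this
    rw [e]
    refine (eLpNorm_add_le (((ha k).sub ha').1.smul (hb k).1)
      (ha'.1.smul ((hb k).sub hb').1) hr).trans ?_
    gcongr
    exact h1.trans (by gcongr)
  have hlim : Tendsto (fun k => eLpNorm (a k - a') p Q *
      (eLpNorm (b k - b') q Q + eLpNorm b' q Q) + eLpNorm a' p Q * eLpNorm (b k - b') q Q)
      atTop (𝓝 0) := by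
    have h1 := ENNReal.Tendsto.mul hla (Or.inr (by simpa using hb'.2.ne))
      (hlb.add tendsto_const_nhds) (Or.inr ENNReal.zero_ne_top) (b := 0 + eLpNorm b' q Q)
    have h2 := ENNReal.Tendsto.const_mul hlb (Or.inr ha'.2.ne)
    simpa using h1.add h2
  exact tendsto_of_tendsto_of_tendsto_of_le_of_le tendsto_const_nhds hlim
    (fun k => zero_le) hbound

lemma tendsto_eLpNorm_norm_sub {p : ENNReal} {f : ℕ → Ω → ℂ} {f' : Ω → ℂ}
    (hl : Tendsto (fun k => eLpNorm (f k - f') p Q) atTop (𝓝 0)) :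
    Tendsto (fun k => eLpNorm ((fun ω => ‖f k ω‖) - fun ω => ‖f' ω‖) p Q) atTop (𝓝 0) := by
  refine tendsto_of_tendsto_of_tendsto_of_le_of_le tendsto_const_nhds hl (fun k => zero_le)
    fun k => eLpNorm_mono fun ω => ?_
  simpa using abs_norm_sub_norm_le (f k ω) (f' ω)

instance holderTriple_four_four_two : ENNReal.HolderTriple 4 4 2 where
  inv_add_inv_eq_inv := by
    rw [← two_mul, show (4 : ENNReal) = 2 * 2 by norm_num,
      ENNReal.mul_inv (by norm_num) (by norm_num), ← mul_assoc,
      ENNReal.mul_inv_cancel (by norm_num) (by norm_num), one_mul]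

lemma tendsto_integral_norm_sq_mul_norm_sq {f g : ℕ → Ω → ℂ} {f' g' : Ω → ℂ}
    (hf : ∀ k, MemLp (f k) 4 Q) (hg : ∀ k, MemLp (g k) 4 Q) (hf' : MemLp f' 4 Q)
    (hg' : MemLp g' 4 Q)
    (hlf : Tendsto (fun k => eLpNorm (f k - f') 4 Q) atTop (𝓝 0))
    (hlg : Tendsto (fun k => eLpNorm (g k - g') 4 Q) atTop (𝓝 0)) :
    Tendsto (fun k => ∫ ω, ‖f k ω‖ ^ 2 * ‖g k ω‖ ^ 2 ∂Q) atTop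
      (𝓝 (∫ ω, ‖f' ω‖ ^ 2 * ‖g' ω‖ ^ 2 ∂Q)) := by
  have h2 : ∀ {f : ℕ → Ω → ℂ} {f' : Ω → ℂ}, (∀ k, MemLp (f k) 4 Q) → MemLp f' 4 Q →
      Tendsto (fun k => eLpNorm (f k - f') 4 Q) atTop (𝓝 0) →
      Tendsto (fun k => eLpNorm ((fun ω => ‖f k ω‖ ^ 2) - fun ω => ‖f' ω‖ ^ 2) 2 Q) atTop
        (𝓝 0) := by
    intro f f' hf hf' hl
    have := tendsto_eLpNorm_mul_sub (r := 2) (by norm_num) (fun k => (hf k).norm)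
      (fun k => (hf k).norm) hf'.norm hf'.norm (by norm_num)
      (tendsto_eLpNorm_norm_sub hl) (tendsto_eLpNorm_norm_sub hl)
    simpa only [pow_two] using! this
  have h1 := tendsto_eLpNorm_mul_sub (p := 2) (q := 2) (r := 1) le_rfl
    (fun k => memLp_norm_sq (hf k)) (fun k => memLp_norm_sq (hg k)) (memLp_norm_sq hf')
    (memLp_norm_sq hg') (by norm_num) (h2 hf hf' hlf) (h2 hg hg' hlg)
  exact tendsto_integral_of_L1' _ (integrable_normSq_mul_normSq hf' hg').1
    (.of_forall fun k => integrable_normSq_mul_normSq (hf k) (hg k)) h1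

/-- The finite sets need only exhaust the support of `f`, not all the indices. -/
lemma tendsto_sum_of_support {f : ℕ → ℝ} (hf : Summable f) {F : ℕ → Finset ℕ} (hF : Monotone F)
    (hcov : ∀ n, f n ≠ 0 → ∃ k, n ∈ F k) :
    Tendsto (fun k => ∑ n ∈ F k, f n) atTop (𝓝 (∑' n, f n)) := by
  classical
  have hG : Tendsto (fun k => F k ∪ (Finset.range k).filter fun n => f n = 0) atTop atTop := by
    refine tendsto_atTop_finset_of_monotone (fun i j hij => ?_) fun n => ?_
    · exact Finset.union_subset_union (hF hij)
        (Finset.filter_subset_filter _ (Finset.range_mono hij))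
    · by_cases h : f n = 0
      · exact ⟨n + 1, Finset.mem_union_right _ (by simp [h])⟩
      · obtain ⟨k, hk⟩ := hcov n h
        exact ⟨k, Finset.mem_union_left _ hk⟩
  refine (hf.hasSum.comp hG).congr fun k => ?_
  simp only [Function.comp]
  refine (Finset.sum_subset Finset.subset_union_left fun n hn hn' => ?_).symm
  simp only [Finset.mem_union, hn', Finset.mem_filter, false_or] at hn
  exact hn.2

variable [IsProbabilityMeasure Q] {Z : ℕ → Ω → ℂ} {μ : Measure ℂ} [IsProbabilityMeasure μ]

lemma eLpNorm_four_sum_mul (hμ : HasCircularMoments μ 2)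
    (hm : ∀ n, Measurable (Z n)) (hZ : ∀ n, HasLaw (Z n) μ Q) (hind : iIndepFun Z Q)
    (F : Finset ℕ) (c : ℕ → ℂ) :
    eLpNorm (fun ω => ∑ n ∈ F, c n * Z n ω) 4 Q =
      ENNReal.ofReal ((2 * (∑ n ∈ F, ‖c n‖ ^ 2) ^ 2) ^ (1 / 4 : ℝ)) := by
  rw [(memLp_sum_mul hμ hZ F c).eLpNorm_eq_integral_rpow_norm (by norm_num) (by norm_num)]
  have h := integral_norm_sq_sum_mul_norm_sq_sum hμ hm hZ hind F c c
  have e : ∑ n ∈ F, c n * starRingEnd ℂ (c n) = ((∑ n ∈ F, ‖c n‖ ^ 2 : ℝ) : ℂ) := by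
    push_cast
    exact Finset.sum_congr rfl fun n _ => Complex.mul_conj' _
  rw [e, Complex.norm_real, Real.norm_eq_abs, sq_abs] at h
  have h4 : ∫ ω, ‖∑ n ∈ F, c n * Z n ω‖ ^ (ENNReal.toReal 4) ∂Q =
      2 * (∑ n ∈ F, ‖c n‖ ^ 2) ^ 2 := by
    rw [show 2 * (∑ n ∈ F, ‖c n‖ ^ 2) ^ 2 = (∑ n ∈ F, ‖c n‖ ^ 2) * (∑ n ∈ F, ‖c n‖ ^ 2) +
      (∑ n ∈ F, ‖c n‖ ^ 2) ^ 2 by ring, ← h]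
    congr with ω
    rw [show ENNReal.toReal 4 = ((4 : ℕ) : ℝ) by norm_num, Real.rpow_natCast]
    ring
  rw [h4]
  norm_num

/-- Almost sure convergence of the partial sums improves to convergence in `L⁴`: the fourth
moments of the increments are controlled by the tails of `∑ |c|²`, and Fatou's lemma applies. -/
lemma memLp_and_tendsto_eLpNorm_sum_sub (hμ : HasCircularMoments μ 2)
    (hm : ∀ n, Measurable (Z n)) (hZ : ∀ n, HasLaw (Z n) μ Q) (hind : iIndepFun Z Q)
    {c : ℕ → ℂ} (hc : Summable fun n => ‖c n‖ ^ 2) {F : ℕ → Finset ℕ} (hF : Monotone F)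
    (hcov : ∀ n, c n ≠ 0 → ∃ k, n ∈ F k) {A : Ω → ℂ}
    (hA : ∀ᵐ ω ∂Q, Tendsto (fun k => ∑ n ∈ F k, c n * Z n ω) atTop (𝓝 (A ω))) :
    MemLp A 4 Q ∧
    Tendsto (fun k => eLpNorm ((fun ω => ∑ n ∈ F k, c n * Z n ω) - A) 4 Q) atTop (𝓝 0) := by
  set S : ℕ → Ω → ℂ := fun k ω => ∑ n ∈ F k, c n * Z n ω with hS
  have hSL : ∀ k, MemLp (S k) 4 Q := fun k => memLp_sum_mul hμ hZ (F k) c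
  set τ : ℕ → ℝ := fun k => ∑' n, ‖c n‖ ^ 2 - ∑ n ∈ F k, ‖c n‖ ^ 2 with hτ
  have hτ0 : Tendsto τ atTop (𝓝 0) := by
    have := (tendsto_sum_of_support hc hF fun n hn => hcov n (by simpa using hn)).const_sub
      (∑' n, ‖c n‖ ^ 2)
    simpa using this
  have hmeasA : AEStronglyMeasurable A Q :=
    aestronglyMeasurable_of_tendsto_ae atTop (fun k => (hSL k).1) hA
  have hb : ∀ k, eLpNorm (A - S k) 4 Q ≤ ENNReal.ofReal ((2 * τ k ^ 2) ^ (1 / 4 : ℝ)) := by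
    intro k
    refine Lp.eLpNorm_le_of_ae_tendsto (u := atTop) (f := fun l => S l - S k) ?_
      (fun l => ((hSL l).sub (hSL k)).1) ?_
    · filter_upwards [eventually_ge_atTop k] with l hl
      have e : S l - S k = fun ω => ∑ n ∈ F l \ F k, c n * Z n ω := by
        ext ω
        simp only [hS, Pi.sub_apply]
        rw [← Finset.sum_sdiff (hF hl), add_sub_cancel_right]
      rw [e, eLpNorm_four_sum_mul hμ hm hZ hind]
      have h1 : ∑ n ∈ F l \ F k, ‖c n‖ ^ 2 ≤ τ k := by
        rw [hτ, le_sub_iff_add_le, Finset.sum_sdiff (hF hl)]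
        exact hc.sum_le_tsum _ fun n _ => by positivity
      gcongr
    · filter_upwards [hA] with ω hω
      exact hω.sub_const _
  have hlim : Tendsto (fun k => ENNReal.ofReal ((2 * τ k ^ 2) ^ (1 / 4 : ℝ))) atTop (𝓝 0) := by
    have h1 : Tendsto (fun k => (2 * τ k ^ 2) ^ (1 / 4 : ℝ)) atTop (𝓝 0) := by
      have := ((hτ0.pow 2).const_mul 2).rpow_const (p := (1 / 4 : ℝ)) (Or.inr (by norm_num))
      simpa using this
    simpa using ENNReal.tendsto_ofReal h1
  constructor
  · have h0 : MemLp (A - S 0) 4 Q :=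
      ⟨hmeasA.sub (hSL 0).1, (hb 0).trans_lt ENNReal.ofReal_lt_top⟩
    simpa using h0.add (hSL 0)
  · refine tendsto_of_tendsto_of_tendsto_of_le_of_le tendsto_const_nhds hlim
      (fun k => zero_le) fun k => ?_
    simp only
    rw [eLpNorm_sub_comm]
    exact hb k

/-- The second-order moments of `a e + A` and `a e + B`, where `A = ∑ c Z` and `B = ∑ d Z` are
sums of independent circular variables with `κ = 2`, and `e` is an independent phase factor. -/
lemma integral_norm_sq_mul_norm_sq_of_tendsto (hμ : HasCircularMoments μ 2)
    (hm : ∀ n, Measurable (Z n)) (hZ : ∀ n, HasLaw (Z n) μ Q) (hind : iIndepFun Z Q)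
    {μe : Measure ℂ} [IsProbabilityMeasure μe] (hμe : HasCircularMoments μe 1) {e : Ω → ℂ}
    (he : HasLaw e μe Q) (hie : IndepFun (fun ω n => Z n ω) e Q)
    {c d : ℕ → ℝ} (hc : Summable fun n => c n ^ 2) (hd : Summable fun n => d n ^ 2)
    {F : ℕ → Finset ℕ} (hF : Monotone F) (hcovc : ∀ n, c n ≠ 0 → ∃ k, n ∈ F k)
    (hcovd : ∀ n, d n ≠ 0 → ∃ k, n ∈ F k) {A B : Ω → ℂ}
    (hA : ∀ᵐ ω ∂Q, Tendsto (fun k => ∑ n ∈ F k, (c n : ℂ) * Z n ω) atTop (𝓝 (A ω)))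
    (hB : ∀ᵐ ω ∂Q, Tendsto (fun k => ∑ n ∈ F k, (d n : ℂ) * Z n ω) atTop (𝓝 (B ω))) (a : ℝ) :
    Integrable (fun ω => ‖A ω + a * e ω‖ ^ 2) Q ∧
    Integrable (fun ω => ‖A ω + a * e ω‖ ^ 2 * ‖B ω + a * e ω‖ ^ 2) Q ∧
    ∫ ω, ‖A ω + a * e ω‖ ^ 2 ∂Q = (∑' n, c n ^ 2) + a ^ 2 ∧
    ∫ ω, ‖A ω + a * e ω‖ ^ 2 * ‖B ω + a * e ω‖ ^ 2 ∂Q =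
      ((∑' n, c n ^ 2) + a ^ 2) * ((∑' n, d n ^ 2) + a ^ 2) + (∑' n, c n * d n) ^ 2 +
        2 * a ^ 2 * ∑' n, c n * d n := by
  have hn : ∀ (c : ℕ → ℝ) n, ‖(c n : ℂ)‖ ^ 2 = c n ^ 2 := fun c n => by
    rw [Complex.norm_real, Real.norm_eq_abs, sq_abs]
  have hcd : Summable fun n => c n * d n := by
    refine (hc.add hd).of_norm_bounded fun n => ?_
    rw [Real.norm_eq_abs, abs_le]
    constructor <;> nlinarith [sq_nonneg (c n + d n), sq_nonneg (c n - d n), sq_nonneg (c n),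
      sq_nonneg (d n)]
  have heL : MemLp e 4 Q := hμe.memLp_of_hasLaw he
  obtain ⟨hAL, hAt⟩ := memLp_and_tendsto_eLpNorm_sum_sub hμ hm hZ hind (c := fun n => (c n : ℂ))
    (by simpa only [hn] using hc) hF (by simpa using hcovc) hA
  obtain ⟨hBL, hBt⟩ := memLp_and_tendsto_eLpNorm_sum_sub hμ hm hZ hind (c := fun n => (d n : ℂ))
    (by simpa only [hn] using hd) hF (by simpa using hcovd) hB
  set Sc : ℕ → Ω → ℂ := fun k ω => ∑ n ∈ F k, (c n : ℂ) * Z n ω with hSc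
  set Sd : ℕ → Ω → ℂ := fun k ω => ∑ n ∈ F k, (d n : ℂ) * Z n ω with hSd
  have hScL : ∀ k, MemLp (Sc k) 4 Q := fun k => memLp_sum_mul hμ hZ (F k) _
  have hSdL : ∀ k, MemLp (Sd k) 4 Q := fun k => memLp_sum_mul hμ hZ (F k) _
  have hae : MemLp (fun ω => (a : ℂ) * e ω) 4 Q := heL.const_mul _
  have hshift : ∀ (S : ℕ → Ω → ℂ) (A : Ω → ℂ),
      Tendsto (fun k => eLpNorm (S k - A) 4 Q) atTop (𝓝 0) →
      Tendsto (fun k => eLpNorm ((fun ω => S k ω + a * e ω) - fun ω => A ω + a * e ω) 4 Q) atTop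
        (𝓝 0) := fun S A h => by
    refine h.congr fun k => ?_
    congr 1
    ext ω
    simp
  have hpair : ∀ k, IndepFun (fun ω => (Sc k ω, Sd k ω)) e Q := fun k =>
    hie.comp (φ := fun z : ℕ → ℂ => (∑ n ∈ F k, (c n : ℂ) * z n, ∑ n ∈ F k, (d n : ℂ) * z n))
      (by fun_prop) measurable_id
  have hpairc : ∀ k, IndepFun (fun ω => (Sc k ω, Sc k ω)) e Q := fun k =>
    hie.comp (φ := fun z : ℕ → ℂ => (∑ n ∈ F k, (c n : ℂ) * z n, ∑ n ∈ F k, (c n : ℂ) * z n))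
      (by fun_prop) measurable_id
  have tc := tendsto_sum_of_support hc hF fun n h => hcovc n (by simpa using h)
  have td := tendsto_sum_of_support hd hF fun n h => hcovd n (by simpa using h)
  have tcd := tendsto_sum_of_support hcd hF fun n h => hcovc n (left_ne_zero_of_mul h)
  refine ⟨(memLp_norm_sq (hAL.add hae)).integrable (by norm_num),
    integrable_normSq_mul_normSq (hAL.add hae) (hBL.add hae), ?_, ?_⟩
  · have hone : MemLp (fun _ : Ω => (1 : ℂ)) 4 Q := memLp_const 1
    have h1 := tendsto_integral_norm_sq_mul_norm_sq (fun k => (hScL k).add hae) (fun _ => hone)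
      (hAL.add hae) hone (hshift Sc A hAt) (by simp)
    simp only [norm_one, one_pow, mul_one] at h1
    refine tendsto_nhds_unique h1 ((tc.add_const (a ^ 2)).congr fun k => ?_)
    have h2 := integral_add_mul_conj_add_of_indep hμe (hScL k) (hScL k) he (hpairc k) a a
    rw [integral_sum_mul_conj_sum hμ hm hZ hind, ← ofReal_integral_norm_sq] at h2
    apply Complex.ofReal_injective
    simp only [Pi.add_apply]
    rw [h2]
    push_cast
    simp only [Complex.conj_ofReal, pow_two]
  · have h1 := tendsto_integral_norm_sq_mul_norm_sq (fun k => (hScL k).add hae)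
      (fun k => (hSdL k).add hae) (hAL.add hae) (hBL.add hae) (hshift Sc A hAt) (hshift Sd B hBt)
    refine tendsto_nhds_unique h1 (((((tc.add_const (a ^ 2)).mul (td.add_const (a ^ 2))).add
      (tcd.pow 2)).add (tcd.const_mul (2 * a ^ 2))).congr fun k => ?_)
    simp only [Pi.add_apply]
    rw [integral_norm_add_sq_mul_of_indep hμe (hScL k) (hSdL k) he (hpair k) a a,
      integral_norm_sq_sum_mul_norm_sq_sum hμ hm hZ hind, integral_norm_sq_sum hμ hm hZ hind,
      integral_norm_sq_sum hμ hm hZ hind, integral_sum_mul_conj_sum hμ hm hZ hind]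
    have e1 : ∑ n ∈ F k, (c n : ℂ) * starRingEnd ℂ (d n : ℂ) =
        ((∑ n ∈ F k, c n * d n : ℝ) : ℂ) := by
      push_cast
      simp only [Complex.conj_ofReal]
    rw [e1, Complex.conj_ofReal, ← Complex.ofReal_mul, ← Complex.ofReal_mul, Complex.ofReal_re]
    simp only [Complex.norm_real, Real.norm_eq_abs, sq_abs]
    ring

end LimitMoments

/-! ### Campbell's formulas for a Poisson point process -/

section Campbell

open scoped NNReal ENNReal

/-- The Stein–Chen identity `E[K f(K)] = r E[f(K + 1)]` for a Poisson variable `K` of mean `r`. -/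
lemma lintegral_natCast_mul_poissonMeasure (r : ℝ≥0) (f : ℕ → ℝ≥0∞) :
    ∫⁻ k, (k : ℝ≥0∞) * f k ∂(poissonMeasure r) = r * ∫⁻ k, f (k + 1) ∂(poissonMeasure r) := by
  have h : ∀ g : ℕ → ℝ≥0∞, ∫⁻ k, g k ∂(poissonMeasure r) =
      ∑' n : ℕ, ENNReal.ofReal (Real.exp (-r) * r ^ n / n.factorial) * g n := fun g => by
    rw [poissonMeasure, lintegral_sum_measure]
    simp
  rw [h, h, tsum_eq_zero_add' ENNReal.summable, ← ENNReal.tsum_mul_left]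
  simp only [Nat.cast_zero, zero_mul, mul_zero, zero_add]
  congr with n
  rw [← mul_assoc, ← mul_assoc]
  congr 1
  rw [← ENNReal.ofReal_coe_nnreal, ← ENNReal.ofReal_natCast, ← ENNReal.ofReal_mul (by positivity),
    ← ENNReal.ofReal_mul (by positivity)]
  congr 1
  rw [Nat.factorial_succ]
  push_cast
  field_simp
  ring

lemma lintegral_natCast_poissonMeasure (r : ℝ≥0) :
    ∫⁻ k, (k : ℝ≥0∞) ∂(poissonMeasure r) = r := by
  simpa using lintegral_natCast_mul_poissonMeasure r 1

lemma lintegral_natCast_sq_poissonMeasure (r : ℝ≥0) :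
    ∫⁻ k, (k : ℝ≥0∞) * k ∂(poissonMeasure r) = r * r + r := by
  rw [lintegral_natCast_mul_poissonMeasure r fun k => k]
  simp only [Nat.cast_add, Nat.cast_one]
  rw [lintegral_add_right _ measurable_const, lintegral_natCast_poissonMeasure]
  simp [mul_add]

lemma measure_ext_of_forall_finite {S : Type*} [MeasurableSpace S] (ν : Measure S) [SigmaFinite ν]
    {μ₁ μ₂ : Measure S} (h : ∀ B, MeasurableSet B → ν B ≠ ⊤ → μ₁ B = μ₂ B) : μ₁ = μ₂ := by
  ext B hB
  have hm : Monotone fun i => B ∩ spanningSets ν i := fun i j hij =>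
    Set.inter_subset_inter_right _ (monotone_spanningSets ν hij)
  have hU : ⋃ i, B ∩ spanningSets ν i = B := by
    rw [← Set.inter_iUnion, iUnion_spanningSets, Set.inter_univ]
  rw [← hU, hm.measure_iUnion, hm.measure_iUnion]
  congr with i
  exact h _ (hB.inter (measurableSet_spanningSets ν i))
    ((measure_mono Set.inter_subset_right).trans_lt (measure_spanningSets_lt_top ν i)).ne

lemma toENNReal_pointCount {Ω S : Type*} (X : ℕ → Ω → S) (B : Set S) (ω : Ω) :
    (pointCount X B ω : ℝ≥0∞) = ∑' n, B.indicator 1 (X n ω) := by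
  rw [pointCount, ← ENNReal.tsum_set_one, tsum_subtype {n | X n ω ∈ B} fun _ => (1 : ℝ≥0∞)]
  rfl

variable {Ω S : Type*} [MeasurableSpace Ω] [MeasurableSpace S] {X : ℕ → Ω → S} {ν : Measure S}
  {P : Measure Ω}

namespace IsPoissonPointProcess

lemma measurable_tsum (hX : IsPoissonPointProcess X ν P) {f : S → ℝ≥0∞} (hf : Measurable f) :
    Measurable fun ω => ∑' n, f (X n ω) :=
  Measurable.tsum fun n => hf.comp (hX.measurable n)

/-- The points that lie in `B` are counted as a sum, whose law is the Poisson law of mean `ν B`. -/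
lemma lintegral_comp_count (hX : IsPoissonPointProcess X ν P) {B : Set S} (hB : MeasurableSet B)
    (hν : ν B ≠ ⊤) (g : ℝ≥0∞ → ℝ≥0∞) :
    ∫⁻ ω, g (∑' n, B.indicator 1 (X n ω)) ∂P =
      ∫⁻ k : ℕ, g k ∂(poissonMeasure (ν B).toNNReal) := by
  have h := hX.hasLaw_count B hB hν
  simp only [← toENNReal_pointCount]
  rw [← lintegral_map' (f := fun k : ℕ∞ => g k) Measurable.of_discrete.aemeasurable h.aemeasurable,
    h.map_eq, lintegral_map .of_discrete .of_discrete]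
  simp

lemma lintegral_count (hX : IsPoissonPointProcess X ν P) {B : Set S} (hB : MeasurableSet B)
    (hν : ν B ≠ ⊤) :
    ∫⁻ ω, ∑' n, B.indicator 1 (X n ω) ∂P = ν B := by
  rw [hX.lintegral_comp_count hB hν fun k => k, lintegral_natCast_poissonMeasure,
    ENNReal.coe_toNNReal hν]

lemma lintegral_count_sq (hX : IsPoissonPointProcess X ν P) {B : Set S} (hB : MeasurableSet B)
    (hν : ν B ≠ ⊤) :
    ∫⁻ ω, (∑' n, B.indicator 1 (X n ω)) * ∑' n, B.indicator 1 (X n ω) ∂P = ν B * ν B + ν B := by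
  rw [hX.lintegral_comp_count hB hν fun k => k * k, lintegral_natCast_sq_poissonMeasure,
    ENNReal.coe_toNNReal hν]

lemma lintegral_count_mul_count_of_disjoint (hX : IsPoissonPointProcess X ν P) {A B : Set S}
    (hA : MeasurableSet A)
    (hB : MeasurableSet B) (hνA : ν A ≠ ⊤) (hνB : ν B ≠ ⊤) (hAB : Disjoint A B) :
    ∫⁻ ω, (∑' n, A.indicator 1 (X n ω)) * ∑' n, B.indicator 1 (X n ω) ∂P = ν A * ν B := by
  have h := hX.iIndep_count 2 ![A, B] (by simp [Fin.forall_fin_two, hA, hB])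
    (by
      intro i j hij
      fin_cases i <;> fin_cases j <;> simp_all [disjoint_comm])
  have h2 := h.indepFun (i := 0) (j := 1) (by decide)
  have h3 := h2.comp (φ := fun k : ℕ∞ => (k : ℝ≥0∞)) (ψ := fun k : ℕ∞ => (k : ℝ≥0∞))
    .of_discrete .of_discrete
  have e : ∀ B : Set S, (fun k : ℕ∞ => (k : ℝ≥0∞)) ∘ pointCount X B =
      fun ω => ∑' n, B.indicator 1 (X n ω) := fun B => by
    ext ω; exact toENNReal_pointCount X B ω
  simp only [Matrix.cons_val_zero, Matrix.cons_val_one, e] at h3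
  have := lintegral_mul_eq_lintegral_mul_lintegral_of_indepFun
    (hX.measurable_tsum (measurable_one.indicator hA))
    (hX.measurable_tsum (measurable_one.indicator hB)) h3
  simp only [Pi.mul_apply] at this
  rw [this, hX.lintegral_count hA hνA, hX.lintegral_count hB hνB]

/-- Both sets are split along `A ∩ B`, and the counts in disjoint sets are independent. -/
lemma lintegral_count_mul_count (hX : IsPoissonPointProcess X ν P) {A B : Set S}
    (hA : MeasurableSet A)
    (hB : MeasurableSet B) (hνA : ν A ≠ ⊤) (hνB : ν B ≠ ⊤) :
    ∫⁻ ω, (∑' n, A.indicator 1 (X n ω)) * ∑' n, B.indicator 1 (X n ω) ∂P =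
      ν A * ν B + ν (A ∩ B) := by
  have hsplit : ∀ {A B : Set S} (ω : Ω), ∑' n, A.indicator (1 : S → ℝ≥0∞) (X n ω) =
      (∑' n, (A ∩ B).indicator 1 (X n ω)) + ∑' n, (A \ B).indicator 1 (X n ω) := by
    intro A B ω
    rw [← ENNReal.tsum_add]
    congr with n
    have := Set.indicator_union_of_disjoint (Set.disjoint_sdiff_inter (s := A) (t := B)).symm
      (1 : S → ℝ≥0∞)
    rw [Set.inter_union_sdiff] at this
    rw [this]
  have hC := hA.inter hB
  have hA' := hA.diff hB
  have hB' := hB.diff hA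
  have fin : ∀ {D E : Set S}, D ⊆ E → ν E ≠ ⊤ → ν D ≠ ⊤ := fun h h' =>
    ((measure_mono h).trans_lt (lt_top_iff_ne_top.2 h')).ne
  have hνC := fin (Set.inter_subset_left (s := A) (t := B)) hνA
  have hνA' := fin (Set.sdiff_subset (s := A) (t := B)) hνA
  have hνB' := fin (Set.sdiff_subset (s := B) (t := A)) hνB
  have m := fun {D : Set S} (hD : MeasurableSet D) =>
    hX.measurable_tsum (measurable_one.indicator hD)
  have e : ∀ ω, (∑' n, A.indicator (1 : S → ℝ≥0∞) (X n ω)) * ∑' n, B.indicator 1 (X n ω) =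
      (∑' n, (A ∩ B).indicator 1 (X n ω)) * (∑' n, (A ∩ B).indicator 1 (X n ω)) +
      (∑' n, (A ∩ B).indicator 1 (X n ω)) * (∑' n, (B \ A).indicator 1 (X n ω)) +
      (∑' n, (A \ B).indicator 1 (X n ω)) * (∑' n, (A ∩ B).indicator 1 (X n ω)) +
      (∑' n, (A \ B).indicator 1 (X n ω)) * (∑' n, (B \ A).indicator 1 (X n ω)) := by
    intro ω
    rw [hsplit (A := A) (B := B), hsplit (A := B) (B := A), Set.inter_comm B A]
    ring
  simp_rw [e]
  have mm := fun {D E : Set S} (hD : MeasurableSet D) (hE : MeasurableSet E) =>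
    Measurable.fun_mul (m hD) (m hE)
  rw [lintegral_add_right _ (mm hA' hB'), lintegral_add_right _ (mm hA' hC),
    lintegral_add_right _ (mm hC hB'), hX.lintegral_count_sq hC hνC,
    hX.lintegral_count_mul_count_of_disjoint hC hB' hνC hνB'
      (Set.disjoint_sdiff_inter.symm.mono_left (Set.inter_comm A B).le),
    hX.lintegral_count_mul_count_of_disjoint hA' hC hνA' hνC Set.disjoint_sdiff_inter,
    hX.lintegral_count_mul_count_of_disjoint hA' hB' hνA' hνB'
      (Set.disjoint_sdiff_left.mono_right Set.sdiff_subset),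
    ← measure_inter_add_sdiff A hB, ← measure_inter_add_sdiff B hA, Set.inter_comm B A]
  ring

/-- The intensity measure of the process under the (unnormalized) law of density `G`. -/
lemma lintegral_sum_map_withDensity (hX : IsPoissonPointProcess X ν P) {G : Ω → ℝ≥0∞}
    (hG : Measurable G) {f : S → ℝ≥0∞}
    (hf : Measurable f) :
    ∫⁻ x, f x ∂(Measure.sum fun n => (P.withDensity G).map (X n)) =
      ∫⁻ ω, (∑' n, f (X n ω)) * G ω ∂P := by
  rw [lintegral_sum_measure]
  simp_rw [fun n => lintegral_map (μ := P.withDensity G) hf (hX.measurable n)]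
  have hm : ∀ n, Measurable fun ω => f (X n ω) := fun n => hf.comp (hX.measurable n)
  rw [← lintegral_tsum fun n => (hm n).aemeasurable,
    lintegral_withDensity_eq_lintegral_mul _ hG (hX.measurable_tsum hf)]
  simp [mul_comm]

/-- Campbell's formula. -/
lemma lintegral_tsum_eq [SigmaFinite ν] (hX : IsPoissonPointProcess X ν P) {f : S → ℝ≥0∞}
    (hf : Measurable f) :
    ∫⁻ ω, ∑' n, f (X n ω) ∂P = ∫⁻ x, f x ∂ν := by
  have h : (Measure.sum fun n => (P.withDensity 1).map (X n)) = ν := by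
    refine measure_ext_of_forall_finite ν fun B hB hν => ?_
    rw [← hX.lintegral_count hB hν, ← lintegral_indicator_one hB,
      hX.lintegral_sum_map_withDensity measurable_one (measurable_one.indicator hB)]
    simp
  rw [← h, hX.lintegral_sum_map_withDensity measurable_one hf]
  simp

/-- Campbell's second-order formula. The last term collects the pairs of equal points. -/
lemma lintegral_tsum_mul_tsum [SigmaFinite ν] (hX : IsPoissonPointProcess X ν P) {f g : S → ℝ≥0∞}
    (hf : Measurable f)
    (hg : Measurable g) :
    ∫⁻ ω, (∑' n, f (X n ω)) * ∑' n, g (X n ω) ∂P =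
      (∫⁻ x, f x ∂ν) * (∫⁻ x, g x ∂ν) + ∫⁻ x, f x * g x ∂ν := by
  -- the formula is extended from indicators to functions in one variable after the other
  have h1 : ∀ B, MeasurableSet B → ν B ≠ ⊤ →
      (Measure.sum fun n => (P.withDensity fun ω => ∑' n, B.indicator 1 (X n ω)).map (X n)) =
        ν B • ν + ν.restrict B := by
    intro B hB hνB
    refine measure_ext_of_forall_finite ν fun A hA hνA => ?_
    rw [← lintegral_indicator_one hA, hX.lintegral_sum_map_withDensity
      (hX.measurable_tsum (measurable_one.indicator hB)) (measurable_one.indicator hA),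
      hX.lintegral_count_mul_count hA hB hνA hνB]
    simp [Measure.restrict_apply hA, mul_comm]
  have h2 : (Measure.sum fun n => (P.withDensity fun ω => ∑' n, f (X n ω)).map (X n)) =
        (∫⁻ x, f x ∂ν) • ν + ν.withDensity f := by
    refine measure_ext_of_forall_finite ν fun B hB hνB => ?_
    have h3 := hX.lintegral_sum_map_withDensity
      (hX.measurable_tsum (measurable_one.indicator hB)) hf
    rw [h1 B hB hνB, lintegral_add_measure, lintegral_smul_measure] at h3
    rw [← lintegral_indicator_one hB, hX.lintegral_sum_map_withDensity
      (hX.measurable_tsum hf) (measurable_one.indicator hB)]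
    simp_rw [mul_comm (∑' n, B.indicator 1 (X n _))]
    rw [← h3]
    simp [withDensity_apply _ hB, mul_comm]
  have h4 := hX.lintegral_sum_map_withDensity (hX.measurable_tsum hf) hg
  rw [h2, lintegral_add_measure, lintegral_smul_measure,
    lintegral_withDensity_eq_lintegral_mul _ hf hg] at h4
  simp_rw [mul_comm (∑' n, f (X n _))]
  rw [← h4]
  simp

end IsPoissonPointProcess

end Campbell

/-! ### Laws of the coefficients and of the phases -/

section Laws

open scoped NNReal

instance isProbabilityMeasure_uniformPhase : IsProbabilityMeasure uniformPhase := by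
  refine cond_isProbabilityMeasure_of_finite ?_ ?_
  · rw [Real.volume_Ico]
    simp only [ne_eq, ENNReal.ofReal_eq_zero, not_le]
    linarith [Real.pi_pos]
  · rw [Real.volume_Ico]; exact ENNReal.ofReal_ne_top

lemma integral_exp_mul_I_pow_uniformPhase {k : ℕ} (hk : k ≠ 0) :
    ∫ φ, Complex.exp ((φ : ℂ) * Complex.I) ^ k ∂uniformPhase = 0 := by
  have hc : (k : ℂ) * Complex.I ≠ 0 := mul_ne_zero (by exact_mod_cast hk) Complex.I_ne_zero
  have e : ∀ φ : ℝ, Complex.exp ((φ : ℂ) * Complex.I) ^ k =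
      Complex.exp ((k : ℂ) * Complex.I * φ) := fun φ => by
    rw [← Complex.exp_nat_mul]; ring_nf
  simp_rw [e]
  rw [uniformPhase, ProbabilityTheory.cond, integral_smul_measure, integral_Ico_eq_integral_Ioc,
    ← intervalIntegral.integral_of_le (by linarith [Real.pi_pos]), integral_exp_mul_complex hc]
  have h : Complex.exp ((k : ℂ) * Complex.I * (Real.pi : ℝ)) =
      Complex.exp ((k : ℂ) * Complex.I * ((-Real.pi : ℝ) : ℂ)) := by
    have := Complex.exp_periodic.nat_mul k ((k : ℂ) * Complex.I * ((-Real.pi : ℝ) : ℂ))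
    rw [← this]
    congr 1
    push_cast; ring
  rw [h]; simp

/-- A uniform phase that is independent of the amplitude makes a law circular. -/
lemma hasCircularMoments_map_mul_phase {S : Type*} [MeasurableSpace S] {ρ : Measure S}
    [IsProbabilityMeasure ρ] {Y : S → ℂ} {κ : ℝ} (hY : Measurable Y) (hL : MemLp Y 4 ρ)
    (h2 : ∫ s, ‖Y s‖ ^ 2 ∂ρ = 1) (h4 : ∫ s, ‖Y s‖ ^ 4 ∂ρ = κ) :
    HasCircularMoments ((ρ.prod uniformPhase).map
      fun p : S × ℝ => Y p.1 * Complex.exp ((p.2 : ℂ) * Complex.I)) κ := by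
  have hm : Measurable fun p : S × ℝ => Y p.1 * Complex.exp ((p.2 : ℂ) * Complex.I) := by fun_prop
  have hnorm : ∀ p : S × ℝ, ‖Y p.1 * Complex.exp ((p.2 : ℂ) * Complex.I)‖ = ‖Y p.1‖ := fun p => by
    rw [norm_mul, Complex.norm_exp_ofReal_mul_I, mul_one]
  have hreal : ∀ k : ℕ, ∫ p, ‖Y p.1‖ ^ k ∂(ρ.prod uniformPhase) = ∫ s, ‖Y s‖ ^ k ∂ρ := fun k => by
    have := integral_prod_mul (μ := ρ) (ν := uniformPhase) (fun s => ‖Y s‖ ^ k) fun _ => (1 : ℝ)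
    simpa using this
  have hcplx : ∀ (G : S → ℂ) (k : ℕ), k ≠ 0 →
      ∫ p, G p.1 * Complex.exp ((p.2 : ℂ) * Complex.I) ^ k ∂(ρ.prod uniformPhase) = 0 := by
    intro G k hk
    rw [integral_prod_mul (μ := ρ) (ν := uniformPhase) G
      fun φ => Complex.exp ((φ : ℂ) * Complex.I) ^ k, integral_exp_mul_I_pow_uniformPhase hk,
      mul_zero]
  refine ⟨?_, ?_, ?_, ?_, ?_, ?_⟩
  · rw [memLp_map_measure_iff (by fun_prop) hm.aemeasurable]
    exact (hL.comp_fst uniformPhase).congr_norm (by fun_prop) (.of_forall fun p => (hnorm p).symm)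
  · rw [integral_map hm.aemeasurable (by fun_prop)]
    simpa using hcplx Y 1 one_ne_zero
  · rw [integral_map hm.aemeasurable (by fun_prop)]
    simpa [mul_pow] using hcplx (fun s => Y s ^ 2) 2 two_ne_zero
  · rw [integral_map hm.aemeasurable (by fun_prop)]
    simp_rw [hnorm, ← mul_assoc]
    have := hcplx (fun s => ((‖Y s‖ ^ 2 : ℝ) : ℂ) * Y s) 1 one_ne_zero
    simpa only [pow_one] using this
  · rw [integral_map hm.aemeasurable (by fun_prop)]
    simp_rw [hnorm, hreal, h2]
  · rw [integral_map hm.aemeasurable (by fun_prop)]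
    simp_rw [hnorm, hreal, h4]

lemma integrable_pow_gaussianReal (v : ℝ≥0) (k : ℕ) :
    Integrable (fun x : ℝ => x ^ k) (gaussianReal 0 v) := by
  have h := (memLp_id_gaussianReal' (μ := 0) (v := v) k (by simp)).integrable_norm_pow'
  exact h.mono' (by fun_prop) (.of_forall fun x => by simp)

lemma integral_sq_gaussianReal (v : ℝ≥0) : ∫ x, x ^ 2 ∂(gaussianReal 0 v) = v := by
  have h := variance_eq_sub (memLp_id_gaussianReal' (μ := 0) (v := v) 2 (by simp))
  rw [variance_id_gaussianReal] at h
  simpa [integral_id_gaussianReal] using h.symm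

/-- The sum of two independent copies of `x` has the law of `√2 x`, so that the fourth moment `m`
satisfies `4 m = 2 m + 6 v²`. -/
lemma integral_pow_four_gaussianReal (v : ℝ≥0) : ∫ x, x ^ 4 ∂(gaussianReal 0 v) = 3 * v ^ 2 := by
  have h1 : ∫ x, x ^ 4 ∂(gaussianReal 0 (v + v)) = 4 * ∫ x, x ^ 4 ∂(gaussianReal 0 v) := by
    have := gaussianReal_map_const_mul (μ := 0) (v := v) (Real.sqrt 2)
    have e : (NNReal.mk (Real.sqrt 2 ^ 2) (sq_nonneg _) * v) = v + v := by
      ext; simp; ring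
    rw [mul_zero, e] at this
    rw [← this, integral_map (by fun_prop) (by fun_prop), ← integral_const_mul]
    congr with x
    rw [mul_pow, show Real.sqrt 2 ^ 4 = (Real.sqrt 2 ^ 2) ^ 2 by ring, Real.sq_sqrt (by norm_num)]
    norm_num
  have h2 : ∫ x, x ^ 4 ∂(gaussianReal 0 (v + v)) =
      2 * (∫ x, x ^ 4 ∂(gaussianReal 0 v)) + 6 * v ^ 2 := by
    have := gaussianReal_conv_gaussianReal (m₁ := 0) (m₂ := 0) (v₁ := v) (v₂ := v)
    rw [add_zero] at this
    rw [← this, Measure.conv, integral_map (by fun_prop) (by fun_prop)]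
    have e : ∀ p : ℝ × ℝ, (p.1 + p.2) ^ 4 = p.1 ^ 4 * p.2 ^ 0 + (4 * p.1 ^ 3) * p.2 ^ 1 +
        (6 * p.1 ^ 2) * p.2 ^ 2 + (4 * p.1 ^ 1) * p.2 ^ 3 + p.1 ^ 0 * p.2 ^ 4 := fun p => by ring
    simp_rw [e]
    have I := fun k => integrable_pow_gaussianReal v k
    have m1 : ∫ x, x ^ 1 ∂(gaussianReal 0 v) = 0 := by simp [integral_id_gaussianReal]
    have i0 := (I 4).mul_prod (I 0)
    have i1 := ((I 3).const_mul 4).mul_prod (I 1)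
    have i2 := ((I 2).const_mul 6).mul_prod (I 2)
    have i3 := ((I 1).const_mul 4).mul_prod (I 3)
    have i4 := (I 0).mul_prod (I 4)
    rw [integral_add (((i0.fun_add i1).fun_add i2).fun_add i3) i4,
      integral_add ((i0.fun_add i1).fun_add i2) i3, integral_add (i0.fun_add i1) i2,
      integral_add i0 i1, integral_prod_mul (fun x : ℝ => x ^ 4) fun x : ℝ => x ^ 0,
      integral_prod_mul (fun x : ℝ => 4 * x ^ 3) fun x : ℝ => x ^ 1,
      integral_prod_mul (fun x : ℝ => 6 * x ^ 2) fun x : ℝ => x ^ 2,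
      integral_prod_mul (fun x : ℝ => 4 * x ^ 1) fun x : ℝ => x ^ 3,
      integral_prod_mul (fun x : ℝ => x ^ 0) fun x : ℝ => x ^ 4]
    simp only [integral_const_mul, m1, integral_sq_gaussianReal]
    simp
    ring
  linarith

instance isProbabilityMeasure_complexGaussian : IsProbabilityMeasure complexGaussian :=
  Measure.isProbabilityMeasure_map (by fun_prop)

/-- The standard complex Gaussian law is invariant under multiplication by `i`. -/
lemma complexGaussian_map_I_mul : complexGaussian.map (fun z => Complex.I * z) = complexGaussian := by
  have hneg : MeasurePreserving (fun x : ℝ => -x) (gaussianReal 0 (1 / 2))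
      (gaussianReal 0 (1 / 2)) := ⟨measurable_neg, by rw [gaussianReal_map_neg, neg_zero]⟩
  have hT := (hneg.prod (MeasurePreserving.id (gaussianReal 0 (1 / 2)))).comp
    (Measure.measurePreserving_swap (μ := gaussianReal 0 (1 / 2)) (ν := gaussianReal 0 (1 / 2)))
  rw [complexGaussian, Measure.map_map (by fun_prop) (by fun_prop)]
  conv_rhs => rw [← hT.map_eq]
  rw [Measure.map_map (by fun_prop) hT.measurable]
  congr 1
  ext p
  simp only [Function.comp, Prod.map, Prod.fst_swap, Prod.snd_swap, id]
  push_cast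
  linear_combination (p.2 : ℂ) * Complex.I_sq

lemma hasCircularMoments_complexGaussian : HasCircularMoments complexGaussian 2 := by
  have hm : Measurable fun p : ℝ × ℝ => (p.1 : ℂ) + (p.2 : ℂ) * Complex.I := by fun_prop
  have hrot : ∀ F : ℂ → ℂ, Measurable F →
      ∫ z, F z ∂complexGaussian = ∫ z, F (Complex.I * z) ∂complexGaussian := fun F hF => by
    conv_lhs => rw [← complexGaussian_map_I_mul]
    rw [integral_map (by fun_prop) hF.aestronglyMeasurable]
  have hzero : ∀ w : ℂ, w = Complex.I * w → w = 0 := fun w hw => by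
    have h1 : (1 - Complex.I) * w = 0 := by linear_combination hw
    refine (mul_eq_zero.1 h1).resolve_left fun h => ?_
    simpa using congrArg Complex.re h
  have hnormSq : ∀ p : ℝ × ℝ, ‖(p.1 : ℂ) + (p.2 : ℂ) * Complex.I‖ ^ 2 = p.1 ^ 2 + p.2 ^ 2 :=
    fun p => by
      rw [Complex.sq_norm, Complex.normSq_add_mul_I]
  have I := fun k => integrable_pow_gaussianReal (1 / 2) k
  refine ⟨?_, ?_, ?_, ?_, ?_, ?_⟩
  · rw [complexGaussian, memLp_map_measure_iff (by fun_prop) hm.aemeasurable]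
    have h := memLp_id_gaussianReal' (μ := 0) (v := 1 / 2) 4 (by simp)
    have h1 : MemLp (fun p : ℝ × ℝ => (p.1 : ℂ)) 4
      ((gaussianReal 0 (1 / 2)).prod (gaussianReal 0 (1 / 2))) := (h.comp_fst _).ofReal
    have h2 : MemLp (fun p : ℝ × ℝ => (p.2 : ℂ)) 4
      ((gaussianReal 0 (1 / 2)).prod (gaussianReal 0 (1 / 2))) := (h.comp_snd _).ofReal
    exact h1.add (h2.mul_const Complex.I)
  · refine hzero _ ((hrot _ measurable_id).trans ?_)
    rw [← integral_const_mul]; rfl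
  · have h := hrot (fun z => z ^ 2) (by fun_prop)
    simp_rw [mul_pow, Complex.I_sq] at h
    rw [integral_const_mul] at h
    linear_combination h / 2
  · refine hzero _ ((hrot (fun z => ((‖z‖ ^ 2 : ℝ) : ℂ) * z) (by fun_prop)).trans ?_)
    rw [← integral_const_mul]
    congr with z
    rw [norm_mul, Complex.norm_I, one_mul]; ring
  · rw [complexGaussian, integral_map hm.aemeasurable (by fun_prop)]
    simp_rw [hnormSq]
    rw [integral_add ((I 2).comp_fst _) ((I 2).comp_snd _),
      integral_fun_fst (fun x : ℝ => x ^ 2), integral_fun_snd (fun x : ℝ => x ^ 2),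
      integral_sq_gaussianReal]
    simp
    norm_num
  · rw [complexGaussian, integral_map hm.aemeasurable (by fun_prop)]
    have e : ∀ p : ℝ × ℝ, ‖(p.1 : ℂ) + (p.2 : ℂ) * Complex.I‖ ^ 4 =
        p.1 ^ 4 + (2 * p.1 ^ 2) * p.2 ^ 2 + p.2 ^ 4 := fun p => by
      rw [show ‖(p.1 : ℂ) + (p.2 : ℂ) * Complex.I‖ ^ 4 =
        (‖(p.1 : ℂ) + (p.2 : ℂ) * Complex.I‖ ^ 2) ^ 2 by ring, hnormSq]; ring
    simp_rw [e]
    have i1 := (I 4).comp_fst (gaussianReal 0 (1 / 2))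
    have i2 := ((I 2).const_mul 2).mul_prod (I 2)
    have i3 := (I 4).comp_snd (gaussianReal 0 (1 / 2))
    rw [integral_add (i1.fun_add i2) i3, integral_add i1 i2,
      integral_fun_fst (fun x : ℝ => x ^ 4), integral_fun_snd (fun x : ℝ => x ^ 4),
      integral_prod_mul (fun x : ℝ => 2 * x ^ 2) fun x : ℝ => x ^ 2, integral_const_mul,
      integral_sq_gaussianReal, integral_pow_four_gaussianReal]
    simp
    norm_num

lemma measurable_mrtWeight {M : ℕ} : Measurable (mrtWeight : (Fin M → ℂ) → Fin M → ℂ) := by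
  unfold mrtWeight
  fun_prop

lemma sum_norm_sq_mrtWeight {M : ℕ} {g : Fin M → ℂ} (hg : g ≠ 0) :
    ∑ i, ‖mrtWeight g i‖ ^ 2 = 1 := by
  have hpos : 0 < ∑ k, ‖g k‖ ^ 2 := by
    obtain ⟨i, hi⟩ := Function.ne_iff.1 hg
    exact Finset.sum_pos' (fun k _ => by positivity)
      ⟨i, Finset.mem_univ _, pow_pos (norm_pos_iff.2 hi) 2⟩
  simp only [mrtWeight, norm_div, div_pow, Complex.norm_real, Real.norm_eq_abs, sq_abs]
  rw [← Finset.sum_div, Real.sq_sqrt hpos.le, div_self hpos.ne']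

instance isProbabilityMeasure_complexGaussianVec (M : ℕ) :
    IsProbabilityMeasure (complexGaussianVec M) := by
  unfold complexGaussianVec; infer_instance

instance nullSingletonClass_complexGaussian : NullSingletonClass complexGaussian := by
  refine ⟨fun z => ?_⟩
  have h0 := nullSingletonClass_gaussianReal (μ := 0) (v := 1 / 2) (by norm_num)
  rw [complexGaussian, Measure.map_apply (by fun_prop) (measurableSet_singleton z)]
  refine measure_mono_null (t := Set.univ ×ˢ {z.im}) (fun p hp => ?_) ?_
  · have := congrArg Complex.im (show (p.1 : ℂ) + (p.2 : ℂ) * Complex.I = z from hp)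
    simpa using this
  · rw [Measure.prod_prod, measure_singleton, mul_zero]

lemma ae_ne_zero_complexGaussianVec {M : ℕ} (hM : 1 ≤ M) :
    ∀ᵐ g ∂(complexGaussianVec M), g ≠ 0 := by
  have i : Fin M := ⟨0, hM⟩
  have h : ∀ᵐ g ∂(complexGaussianVec M), g i ≠ 0 := by
    have hmp := measurePreserving_eval (fun _ : Fin M => complexGaussian) i
    have h1 : ∀ᵐ z ∂complexGaussian, z ≠ 0 := by simp [ae_iff]
    exact hmp.quasiMeasurePreserving.ae h1
  filter_upwards [h] with g hg h0
  exact hg (by rw [h0]; rfl)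

lemma measurable_dotProduct_mrtWeight {M : ℕ} :
    Measurable fun p : (Fin M → ℂ) × (Fin M → ℂ) => p.1 ⬝ᵥ mrtWeight p.2 := by
  have := measurable_mrtWeight (M := M)
  unfold dotProduct
  fun_prop

/-- Against a unit weight vector, a standard Gaussian channel has the moments of `CN(0, 1)`. -/
lemma moments_dotProduct_of_unit {M : ℕ} {w : Fin M → ℂ} (hw : ∑ i, ‖w i‖ ^ 2 = 1) :
    Integrable (fun h => ‖h ⬝ᵥ w‖ ^ 4) (complexGaussianVec M) ∧
    ∫ h, ‖h ⬝ᵥ w‖ ^ 2 ∂(complexGaussianVec M) = 1 ∧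
    ∫ h, ‖h ⬝ᵥ w‖ ^ 4 ∂(complexGaussianVec M) = 2 := by
  have hm : ∀ i : Fin M, Measurable fun h : Fin M → ℂ => h i := fun i => measurable_pi_apply i
  have hlaw : ∀ i : Fin M, HasLaw (fun h : Fin M → ℂ => h i) complexGaussian
      (complexGaussianVec M) := fun i =>
    (measurePreserving_eval (fun _ : Fin M => complexGaussian) i).hasLaw
  have hind : iIndepFun (fun (i : Fin M) (h : Fin M → ℂ) => h i) (complexGaussianVec M) :=
    iIndepFun_pi (X := fun _ z => z) fun _ => aemeasurable_id
  have e : ∀ h : Fin M → ℂ, h ⬝ᵥ w = ∑ i, w i * h i := fun h => by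
    rw [dotProduct_comm]; rfl
  have h4 : ∀ x : ℂ, ‖x‖ ^ 4 = ‖x‖ ^ 2 * ‖x‖ ^ 2 := fun x => by ring
  have hL := memLp_sum_mul hasCircularMoments_complexGaussian hlaw Finset.univ w
  have hww : ∑ i, w i * starRingEnd ℂ (w i) = ((∑ i, ‖w i‖ ^ 2 : ℝ) : ℂ) := by
    push_cast
    exact Finset.sum_congr rfl fun n _ => Complex.mul_conj' _
  simp_rw [h4, e]
  refine ⟨integrable_normSq_mul_normSq hL hL, ?_, ?_⟩
  · rw [integral_norm_sq_sum hasCircularMoments_complexGaussian hm hlaw hind, hw]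
  · rw [integral_norm_sq_sum_mul_norm_sq_sum hasCircularMoments_complexGaussian hm hlaw hind,
      hww, hw]
    norm_num

/-- The law of the coefficient `(h ⬝ w) e^{jφ}` of a reader. -/
def coefficientLaw (M : ℕ) : Measure ℂ :=
  ((complexGaussianVec M).prod ((complexGaussianVec M).prod uniformPhase)).map
    fun q => (q.1 ⬝ᵥ mrtWeight q.2.1) * Complex.exp ((q.2.2 : ℂ) * Complex.I)

/-- The law of the phase factor `e^{jφ}`. -/
def phaseLaw : Measure ℂ :=
  uniformPhase.map fun φ : ℝ => Complex.exp ((φ : ℂ) * Complex.I)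

lemma measurable_coefficient {M : ℕ} :
    Measurable fun q : (Fin M → ℂ) × (Fin M → ℂ) × ℝ =>
      (q.1 ⬝ᵥ mrtWeight q.2.1) * Complex.exp ((q.2.2 : ℂ) * Complex.I) := by
  have h := (measurable_dotProduct_mrtWeight (M := M)).comp
    (f := fun q : (Fin M → ℂ) × (Fin M → ℂ) × ℝ => (q.1, q.2.1)) (by fun_prop)
  exact h.mul (by fun_prop)

instance isProbabilityMeasure_coefficientLaw (M : ℕ) : IsProbabilityMeasure (coefficientLaw M) :=
  Measure.isProbabilityMeasure_map measurable_coefficient.aemeasurable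

instance isProbabilityMeasure_phaseLaw : IsProbabilityMeasure phaseLaw :=
  Measure.isProbabilityMeasure_map (by fun_prop)

lemma hasCircularMoments_phaseLaw : HasCircularMoments phaseLaw 1 := by
  have h := hasCircularMoments_map_mul_phase (ρ := Measure.dirac ()) (Y := fun _ => (1 : ℂ)) (κ := 1)
    measurable_const (memLp_const 1) (by simp) (by simp)
  have e : ((Measure.dirac ()).prod uniformPhase).map
      (fun p : Unit × ℝ => (1 : ℂ) * Complex.exp ((p.2 : ℂ) * Complex.I)) = phaseLaw := by
    simp only [one_mul]
    have := Measure.map_snd_prod (μ := Measure.dirac ()) (ν := uniformPhase)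
    rw [measure_univ, one_smul] at this
    conv_rhs => rw [phaseLaw, ← this, Measure.map_map (by fun_prop) (by fun_prop)]
    rfl
  rwa [e] at h

lemma hasCircularMoments_coefficientLaw {M : ℕ} (hM : 1 ≤ M) :
    HasCircularMoments (coefficientLaw M) 2 := by
  set γ := complexGaussianVec M with hγ
  have hY := measurable_dotProduct_mrtWeight (M := M)
  have hunit : ∀ᵐ g ∂γ, ∑ i, ‖mrtWeight g i‖ ^ 2 = 1 :=
    (ae_ne_zero_complexGaussianVec hM).mono fun g hg => sum_norm_sq_mrtWeight hg
  have hint : Integrable (fun p : (Fin M → ℂ) × (Fin M → ℂ) => ‖p.1 ⬝ᵥ mrtWeight p.2‖ ^ 4)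
      (γ.prod γ) := by
    rw [integrable_prod_iff' (hY.norm.pow_const 4).aestronglyMeasurable]
    refine ⟨hunit.mono fun g hg => (moments_dotProduct_of_unit hg).1, ?_⟩
    refine (integrable_const (2 : ℝ)).congr (hunit.mono fun g hg => ?_)
    simp only [norm_pow, norm_norm]
    exact (moments_dotProduct_of_unit hg).2.2.symm
  have hL : MemLp (fun p : (Fin M → ℂ) × (Fin M → ℂ) => p.1 ⬝ᵥ mrtWeight p.2) 4 (γ.prod γ) := by
    rw [← integrable_norm_rpow_iff hY.aestronglyMeasurable (by norm_num) (by norm_num)]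
    simpa using hint
  have h2 : Integrable (fun p : (Fin M → ℂ) × (Fin M → ℂ) => ‖p.1 ⬝ᵥ mrtWeight p.2‖ ^ 2)
      (γ.prod γ) := (memLp_norm_sq hL).integrable (by norm_num)
  have h := hasCircularMoments_map_mul_phase (κ := 2) hY hL
    (by
      rw [integral_prod_symm _ h2, integral_congr_ae (g := fun _ => (1 : ℝ))
        (hunit.mono fun g hg => (moments_dotProduct_of_unit hg).2.1)]
      simp)
    (by
      rw [integral_prod_symm _ hint, integral_congr_ae (g := fun _ => (2 : ℝ))
        (hunit.mono fun g hg => (moments_dotProduct_of_unit hg).2.2)]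
      simp)
  have e : ((γ.prod γ).prod uniformPhase).map (fun p => (p.1.1 ⬝ᵥ mrtWeight p.1.2) *
      Complex.exp ((p.2 : ℂ) * Complex.I)) = coefficientLaw M := by
    rw [coefficientLaw, ← (measurePreserving_prodAssoc γ γ uniformPhase).map_eq,
      Measure.map_map measurable_coefficient (by fun_prop)]
    rfl
  rwa [e] at h

/-- The coefficient `(h ⬝ w) e^{jφ}` of the reader number `n`. -/
def TagEnvironment.coefficient {Ω : Type*} {M : ℕ} (N : TagEnvironment Ω M) (n : ℕ) (ω : Ω) : ℂ :=
  (N.crossChannel n ω ⬝ᵥ mrtWeight (N.ownChannel n ω)) * Complex.exp ((N.phase n ω : ℂ) * Complex.I)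

/-- The joint law of the phase factor of the typical pair and of the coefficients of the readers. -/
def markLaw (M : ℕ) : Measure (ℂ × (ℕ → ℂ)) :=
  phaseLaw.prod (Measure.infinitePi fun _ => coefficientLaw M)

instance isProbabilityMeasure_markLaw (M : ℕ) : IsProbabilityMeasure (markLaw M) := by
  unfold markLaw; infer_instance

/-- The locations and starting times of the readers are independent of the phase factor of the
typical pair and of the coefficients, which are themselves independent. -/
lemma TagEnvironment.IsModel.hasLaw_reader_marks {Ω : Type*} [MeasurableSpace Ω] {P : Measure Ω}
    [IsProbabilityMeasure P] {M : ℕ} {N : TagEnvironment Ω M} {lam : ℝ} (hN : N.IsModel lam P) :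
    HasLaw (fun ω => ((fun n => N.reader n ω),
        (Complex.exp ((N.tagPhase ω : ℂ) * Complex.I), fun n => N.coefficient n ω)))
      ((P.map fun ω n => N.reader n ω).prod (markLaw M)) P := by
  have hX : Measurable fun ω n => N.reader n ω := measurable_pi_iff.2 hN.poisson.measurable
  have hZ : ∀ n, HasLaw (N.coefficient n) (coefficientLaw M) P := fun n =>
    HasLaw.comp (Y := fun q : (Fin M → ℂ) × (Fin M → ℂ) × ℝ =>
      (q.1 ⬝ᵥ mrtWeight q.2.1) * Complex.exp ((q.2.2 : ℂ) * Complex.I))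
      ⟨measurable_coefficient.aemeasurable, rfl⟩ (hN.hasLaw_mark n)
  have hZind : iIndepFun N.coefficient P :=
    hN.iIndep_mark.comp (fun _ q => (q.1 ⬝ᵥ mrtWeight q.2.1) *
      Complex.exp ((q.2.2 : ℂ) * Complex.I)) fun _ => measurable_coefficient
  have hZseq : HasLaw (fun ω n => N.coefficient n ω)
      (Measure.infinitePi fun _ => coefficientLaw M) P :=
    hZind.hasLaw_infinitePi hZ (aemeasurable_pi_iff.2 fun n => (hZ n).aemeasurable)
  have he : HasLaw (fun ω => Complex.exp ((N.tagPhase ω : ℂ) * Complex.I)) phaseLaw P :=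
    HasLaw.comp (Y := fun φ : ℝ => Complex.exp ((φ : ℂ) * Complex.I))
      ⟨by fun_prop, rfl⟩ hN.hasLaw_tagPhase
  have hseq : Measurable fun (q : ℕ → (Fin M → ℂ) × (Fin M → ℂ) × ℝ) (n : ℕ) =>
      ((q n).1 ⬝ᵥ mrtWeight (q n).2.1) * Complex.exp (((q n).2.2 : ℂ) * Complex.I) :=
    measurable_pi_iff.2 fun n => measurable_coefficient.comp (measurable_pi_apply n)
  have hphase : Measurable fun φ : ℝ => Complex.exp ((φ : ℂ) * Complex.I) := by fun_prop
  have hez : IndepFun (fun ω => Complex.exp ((N.tagPhase ω : ℂ) * Complex.I))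
      (fun ω n => N.coefficient n ω) P := hN.indep_tagPhase.comp hphase hseq
  have hmarks : HasLaw (fun ω => (Complex.exp ((N.tagPhase ω : ℂ) * Complex.I),
      fun n => N.coefficient n ω)) (markLaw M) P :=
    ⟨he.aemeasurable.prodMk hZseq.aemeasurable, by
      rw [(indepFun_iff_map_prod_eq_prod_map_map he.aemeasurable hZseq.aemeasurable).1 hez,
        he.map_eq, hZseq.map_eq, markLaw]⟩
  have hxm : IndepFun (fun ω n => N.reader n ω) (fun ω =>
      (Complex.exp ((N.tagPhase ω : ℂ) * Complex.I), fun n => N.coefficient n ω)) P :=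
    hN.indep_reader.comp measurable_id
      ((hphase.comp measurable_fst).prodMk (hseq.comp measurable_snd))
  refine ⟨hX.aemeasurable.prodMk hmarks.aemeasurable, ?_⟩
  rw [(indepFun_iff_map_prod_eq_prod_map_map hX.aemeasurable hmarks.aemeasurable).1 hxm,
    hmarks.map_eq]

lemma hasLaw_fst_markLaw (M : ℕ) : HasLaw (fun m => m.1) phaseLaw (markLaw M) :=
  ⟨by fun_prop, by rw [markLaw, Measure.map_fst_prod]; simp⟩

lemma hasLaw_coefficient_markLaw (M : ℕ) (n : ℕ) :
    HasLaw (fun m => m.2 n) (coefficientLaw M) (markLaw M) := by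
  have h1 : MeasurePreserving (fun m : ℂ × (ℕ → ℂ) => m.2) (markLaw M)
      (Measure.infinitePi fun _ => coefficientLaw M) := measurePreserving_snd
  exact ((measurePreserving_eval_infinitePi (fun _ : ℕ => coefficientLaw M) n).comp h1).hasLaw

lemma iIndepFun_coefficient_markLaw (M : ℕ) :
    iIndepFun (fun n (m : ℂ × (ℕ → ℂ)) => m.2 n) (markLaw M) := by
  rw [iIndepFun_iff_map_fun_eq_infinitePi_map (by fun_prop)]
  simp_rw [fun n => (hasLaw_coefficient_markLaw M n).map_eq]
  rw [markLaw]
  exact (measurePreserving_snd (μ := phaseLaw)).map_eq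

lemma indepFun_markLaw (M : ℕ) :
    IndepFun (fun (m : ℂ × (ℕ → ℂ)) n => m.2 n) (fun m => m.1) (markLaw M) :=
  (indepFun_prod measurable_id measurable_id).symm

end Laws

/-! ### The signal, given the configuration of the readers -/

section Configuration

/-- The amplitude `e(t, t_x) L(‖x‖)^(-α/2)` with which a reader at `p = (x, t_x)` is received. -/
def readerWeight (T α ro t : ℝ) (p : Plane × ℝ) : ℝ :=
  if p.2 ≤ t ∧ t ≤ p.2 + T then max ‖p.1‖ ro ^ (-α / 2) else 0

/-- A common upper bound of the amplitudes `readerWeight T α ro t` for `t ∈ [0, T1]`. -/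
def windowWeight (T T1 α ro : ℝ) (p : Plane × ℝ) : ℝ :=
  if -T ≤ p.2 ∧ p.2 ≤ T1 then max ‖p.1‖ ro ^ (-α / 2) else 0

/-- The sum of the contributions of the readers `x n` within distance `R`, for coefficients `z`. -/
def interferenceWithin (T α ro R t : ℝ) (x : ℕ → Plane × ℝ) (z : ℕ → ℂ) : ℂ :=
  ∑' n, Set.indicator {m | ‖(x m).1‖ ≤ R} (fun m => (readerWeight T α ro t (x m) : ℂ) * z m) n

/-- The received signal divided by `√P_T`, for a configuration `c.1` of readers, a phase factor
`c.2.1` of amplitude `a`, and coefficients `c.2.2`. It is defined as a limit along the integers,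
which makes it measurable; almost surely it is also the limit along the reals. -/
def normalizedSignal (T α ro a t : ℝ) (c : (ℕ → Plane × ℝ) × ℂ × (ℕ → ℂ)) : ℂ :=
  limUnder atTop (fun k : ℕ => interferenceWithin T α ro k t c.1 c.2.2) + a * c.2.1

/-- Configurations of readers of finite total power, uniformly over the time window `[0, T1]`. -/
def HasFinitePower (T T1 α ro : ℝ) (x : ℕ → Plane × ℝ) : Prop :=
  ∑' n, ENNReal.ofReal (windowWeight T T1 α ro (x n) ^ 2) ≠ ⊤

lemma signalWithin_eq {Ω : Type*} {M : ℕ} (N : TagEnvironment Ω M) {PT : ℝ} (hPT : 0 ≤ PT)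
    (G d0 T α ro R t : ℝ) (ω : Ω) :
    N.signalWithin PT G d0 T α ro R t ω = ((Real.sqrt PT : ℝ) : ℂ) *
      (interferenceWithin T α ro R t (fun n => N.reader n ω) (fun n => N.coefficient n ω) +
        ((Real.sqrt (G * d0 ^ (-α)) : ℝ) : ℂ) * Complex.exp ((N.tagPhase ω : ℂ) * Complex.I)) := by
  have h : ∀ m, N.contribution T α ro t m ω =
      (readerWeight T α ro t (N.reader m ω) : ℂ) * N.coefficient m ω := by
    intro m
    rw [TagEnvironment.contribution, activity, readerWeight, TagEnvironment.coefficient]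
    by_cases hm : (N.reader m ω).2 ≤ t ∧ t ≤ (N.reader m ω).2 + T
    · rw [Set.indicator_of_mem (show t ∈ Set.Icc _ _ from hm), if_pos hm]
      ring
    · rw [Set.indicator_of_notMem (show t ∉ Set.Icc _ _ from hm), if_neg hm]
      simp
  rw [TagEnvironment.signalWithin, interferenceWithin, mul_assoc PT G, Real.sqrt_mul hPT]
  simp only [h]
  push_cast
  ring

lemma measurable_readerWeight (T α ro : ℝ) :
    Measurable fun p : ℝ × (Plane × ℝ) => readerWeight T α ro p.1 p.2 := by
  unfold readerWeight
  have h1 : MeasurableSet {p : ℝ × (Plane × ℝ) | p.2.2 ≤ p.1} :=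
    measurableSet_le (by fun_prop) (by fun_prop)
  have h2 : MeasurableSet {p : ℝ × (Plane × ℝ) | p.1 ≤ p.2.2 + T} :=
    measurableSet_le (by fun_prop) (by fun_prop)
  exact Measurable.ite (h1.inter h2) (by fun_prop) measurable_const

lemma measurable_windowWeight (T T1 α ro : ℝ) : Measurable (windowWeight T T1 α ro) := by
  unfold windowWeight
  have h1 : MeasurableSet {p : Plane × ℝ | -T ≤ p.2} :=
    measurableSet_le (by fun_prop) (by fun_prop)
  have h2 : MeasurableSet {p : Plane × ℝ | p.2 ≤ T1} :=
    measurableSet_le (by fun_prop) (by fun_prop)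
  exact Measurable.ite (h1.inter h2) (by fun_prop) measurable_const

lemma readerWeight_nonneg {T α ro t : ℝ} (hro : 0 ≤ ro) (p : Plane × ℝ) :
    0 ≤ readerWeight T α ro t p := by
  unfold readerWeight
  split_ifs
  · exact Real.rpow_nonneg (hro.trans (le_max_right _ _)) _
  · exact le_rfl

lemma readerWeight_le_windowWeight {T T1 α ro t : ℝ} (hro : 0 ≤ ro) (ht : t ∈ Set.Icc 0 T1)
    (p : Plane × ℝ) : readerWeight T α ro t p ≤ windowWeight T T1 α ro p := by
  unfold readerWeight windowWeight
  split_ifs with h1 h2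
  · exact le_rfl
  · exact absurd ⟨by linarith [ht.1], h1.1.trans ht.2⟩ h2
  · exact Real.rpow_nonneg (hro.trans (le_max_right _ _)) _
  · exact le_rfl

lemma stronglyMeasurable_interferenceWithin (T α ro R : ℝ) :
    StronglyMeasurable fun p : ℝ × ((ℕ → Plane × ℝ) × ℂ × (ℕ → ℂ)) =>
      interferenceWithin T α ro R p.1 p.2.1 p.2.2.2 := by
  unfold interferenceWithin
  refine StronglyMeasurable.tsum fun n => Measurable.stronglyMeasurable ?_
  have h1 : Measurable fun p : ℝ × ((ℕ → Plane × ℝ) × ℂ × (ℕ → ℂ)) =>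
      readerWeight T α ro p.1 (p.2.1 n) :=
    (measurable_readerWeight T α ro).comp (f := fun p : ℝ × ((ℕ → Plane × ℝ) × ℂ × (ℕ → ℂ)) =>
      (p.1, p.2.1 n)) (by fun_prop)
  have h2 : Measurable fun p : ℝ × ((ℕ → Plane × ℝ) × ℂ × (ℕ → ℂ)) =>
      (readerWeight T α ro p.1 (p.2.1 n) : ℂ) * p.2.2.2 n := by fun_prop
  have h3 : MeasurableSet {p : ℝ × ((ℕ → Plane × ℝ) × ℂ × (ℕ → ℂ)) | ‖(p.2.1 n).1‖ ≤ R} :=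
    measurableSet_le (by fun_prop) (by fun_prop)
  exact h2.indicator h3

lemma stronglyMeasurable_normalizedSignal (T α ro a : ℝ) :
    StronglyMeasurable fun p : ℝ × ((ℕ → Plane × ℝ) × ℂ × (ℕ → ℂ)) =>
      normalizedSignal T α ro a p.1 p.2 := by
  unfold normalizedSignal
  refine StronglyMeasurable.add (StronglyMeasurable.limUnder fun k =>
    stronglyMeasurable_interferenceWithin T α ro k) (Measurable.stronglyMeasurable ?_)
  fun_prop

lemma measurableSet_exists_tendsto_rat (T α ro : ℝ) :
    MeasurableSet {p : ℝ × ((ℕ → Plane × ℝ) × ℂ × (ℕ → ℂ)) | ∃ l, Tendsto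
      (fun q : ℚ => interferenceWithin T α ro q p.1 p.2.1 p.2.2.2) atTop (𝓝 l)} :=
  StronglyMeasurable.measurableSet_exists_tendsto fun q =>
    stronglyMeasurable_interferenceWithin T α ro q

namespace HasFinitePower

variable {T T1 α ro : ℝ} {x : ℕ → Plane × ℝ}

lemma summable_window (hx : HasFinitePower T T1 α ro x) :
    Summable fun n => windowWeight T T1 α ro (x n) ^ 2 := by
  have := ENNReal.summable_toReal hx
  simpa only [ENNReal.toReal_ofReal (sq_nonneg _)] using this

lemma summable_sq (hx : HasFinitePower T T1 α ro x) (hro : 0 ≤ ro) {t : ℝ}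
    (ht : t ∈ Set.Icc 0 T1) : Summable fun n => readerWeight T α ro t (x n) ^ 2 :=
  hx.summable_window.of_nonneg_of_le (fun _ => sq_nonneg _) fun _ =>
    pow_le_pow_left₀ (readerWeight_nonneg hro _) (readerWeight_le_windowWeight hro ht _) 2

lemma finite_active (hx : HasFinitePower T T1 α ro x) (hro : 0 < ro) (hα : 0 ≤ α) {t : ℝ}
    (ht : t ∈ Set.Icc 0 T1) (R : ℝ) :
    {n | readerWeight T α ro t (x n) ≠ 0 ∧ ‖(x n).1‖ ≤ R}.Finite := by
  have hε : 0 < (max R ro ^ (-α / 2)) ^ 2 :=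
    pow_pos (Real.rpow_pos_of_pos (hro.trans_le (le_max_right _ _)) _) 2
  have h := (hx.summable_sq hro.le ht).tendsto_cofinite_zero.eventually (gt_mem_nhds hε)
  rw [Filter.eventually_cofinite] at h
  refine h.subset fun n hn => ?_
  simp only [Set.mem_ofPred_eq, not_lt]
  have h1 : readerWeight T α ro t (x n) = max ‖(x n).1‖ ro ^ (-α / 2) := by
    have := hn.1
    unfold readerWeight at this ⊢
    split_ifs at this ⊢
    · rfl
    · exact absurd rfl this
  rw [h1]
  refine pow_le_pow_left₀ (Real.rpow_nonneg (hro.le.trans (le_max_right _ _)) _) ?_ 2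
  exact Real.rpow_le_rpow_of_nonpos (hro.trans_le (le_max_right _ _))
    (max_le_max hn.2 le_rfl) (by linarith)

/-- Only finitely many active readers lie in a given disc, so that the partial sums are step
functions of the radius and rational radii suffice. -/
lemma exists_rat_interferenceWithin_eq (hx : HasFinitePower T T1 α ro x) (hro : 0 < ro)
    (hα : 0 ≤ α) {t : ℝ} (ht : t ∈ Set.Icc 0 T1) (z : ℕ → ℂ) (R : ℝ) :
    ∃ q : ℚ, R ≤ q ∧ interferenceWithin T α ro q t x z = interferenceWithin T α ro R t x z := by
  have hfin := hx.finite_active hro hα ht (R + 1)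
  have hev : ∀ᶠ q in 𝓝[>] R, ∀ n ∈ {n | readerWeight T α ro t (x n) ≠ 0 ∧ ‖(x n).1‖ ≤ R + 1},
      ‖(x n).1‖ ≤ R ∨ q < ‖(x n).1‖ := by
    rw [Filter.eventually_all_finite hfin]
    intro n _
    by_cases h : ‖(x n).1‖ ≤ R
    · simp [h]
    · filter_upwards [Ioo_mem_nhdsGT (not_le.1 h)] with q hq
      exact Or.inr hq.2
  obtain ⟨u, hu, hsub⟩ := mem_nhdsGT_iff_exists_Ioo_subset.1
    (hev.and (Ioo_mem_nhdsGT (lt_add_one R)))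
  obtain ⟨q, hq1, hq2⟩ := exists_rat_btwn (show R < u from hu)
  obtain ⟨hq3, hq4⟩ := hsub ⟨hq1, hq2⟩
  refine ⟨q, hq1.le, ?_⟩
  unfold interferenceWithin
  congr with n
  by_cases h0 : readerWeight T α ro t (x n) = 0
  · simp [Set.indicator, h0]
  have hiff : ‖(x n).1‖ ≤ (q : ℝ) ↔ ‖(x n).1‖ ≤ R := by
    refine ⟨fun h => ?_, fun h => h.trans hq1.le⟩
    exact (hq3 n ⟨h0, h.trans hq4.2.le⟩).resolve_right (not_lt.2 h)
  simp only [Set.indicator, Set.mem_ofPred_eq, hiff]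

lemma exists_tendsto_real_of_rat (hx : HasFinitePower T T1 α ro x) (hro : 0 < ro)
    (hα : 0 ≤ α) {t : ℝ} (ht : t ∈ Set.Icc 0 T1) {z : ℕ → ℂ}
    (h : ∃ l, Tendsto (fun q : ℚ => interferenceWithin T α ro q t x z) atTop (𝓝 l)) :
    ∃ l, Tendsto (fun R : ℝ => interferenceWithin T α ro R t x z) atTop (𝓝 l) := by
  obtain ⟨l, hl⟩ := h
  choose q hq hqe using hx.exists_rat_interferenceWithin_eq hro hα ht z
  have hqt : Tendsto q atTop atTop := by
    rw [← tendsto_ratCast_atTop_iff (R := ℝ)]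
    exact tendsto_atTop_mono hq tendsto_id
  exact ⟨l, (hl.comp hqt).congr hqe⟩

variable {M : ℕ}

lemma ae_exists_tendsto (hx : HasFinitePower T T1 α ro x) (hM : 1 ≤ M) (hro : 0 < ro)
    (hα : 0 ≤ α) {t : ℝ} (ht : t ∈ Set.Icc 0 T1) :
    ∀ᵐ m ∂(markLaw M), ∃ l, Tendsto
      (fun R : ℝ => interferenceWithin T α ro R t x m.2) atTop (𝓝 l) := by
  refine ae_exists_tendsto_tsum_indicator (Q := markLaw M) (μ := coefficientLaw M)
    (hasCircularMoments_coefficientLaw hM)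
    (Z := fun n m => m.2 n) (fun n => by fun_prop) (hasLaw_coefficient_markLaw M)
    (iIndepFun_coefficient_markLaw M) (c := fun n => (readerWeight T α ro t (x n) : ℂ)) ?_
    (r := fun n => ‖(x n).1‖) fun R => ?_
  · simpa using hx.summable_sq hro.le ht
  · simpa using hx.finite_active hro hα ht R

/-- The moments of the normalized signal, given the configuration of the readers. -/
lemma lintegral_normalizedSignal (hx : HasFinitePower T T1 α ro x) (hM : 1 ≤ M) (hro : 0 < ro)
    (hα : 0 ≤ α) {s t : ℝ} (hs : s ∈ Set.Icc 0 T1) (ht : t ∈ Set.Icc 0 T1) (a : ℝ) :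
    ∫⁻ m, ENNReal.ofReal (‖normalizedSignal T α ro a s (x, m)‖ ^ 2) ∂(markLaw M) =
      (∑' n, ENNReal.ofReal (readerWeight T α ro s (x n) ^ 2)) + ENNReal.ofReal (a ^ 2) ∧
    ∫⁻ m, ENNReal.ofReal (‖normalizedSignal T α ro a s (x, m)‖ ^ 2) *
        ENNReal.ofReal (‖normalizedSignal T α ro a t (x, m)‖ ^ 2) ∂(markLaw M) =
      ((∑' n, ENNReal.ofReal (readerWeight T α ro s (x n) ^ 2)) + ENNReal.ofReal (a ^ 2)) *
        ((∑' n, ENNReal.ofReal (readerWeight T α ro t (x n) ^ 2)) + ENNReal.ofReal (a ^ 2)) +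
      (∑' n, ENNReal.ofReal (readerWeight T α ro s (x n) * readerWeight T α ro t (x n))) ^ 2 +
      2 * ENNReal.ofReal (a ^ 2) *
        ∑' n, ENNReal.ofReal (readerWeight T α ro s (x n) * readerWeight T α ro t (x n)) := by
  set c : ℕ → ℝ := fun n => readerWeight T α ro s (x n) with hc
  set d : ℕ → ℝ := fun n => readerWeight T α ro t (x n) with hd
  have hcs : Summable fun n => c n ^ 2 := hx.summable_sq hro.le hs
  have hds : Summable fun n => d n ^ 2 := hx.summable_sq hro.le ht
  have hc0 : ∀ n, 0 ≤ c n := fun n => readerWeight_nonneg hro.le _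
  have hd0 : ∀ n, 0 ≤ d n := fun n => readerWeight_nonneg hro.le _
  have hcd : Summable fun n => c n * d n := by
    refine (hcs.add hds).of_nonneg_of_le (fun n => mul_nonneg (hc0 n) (hd0 n)) fun n => ?_
    nlinarith [sq_nonneg (c n - d n), sq_nonneg (c n), sq_nonneg (d n)]
  have hfin : ∀ R : ℝ, {n | (c n ≠ 0 ∨ d n ≠ 0) ∧ ‖(x n).1‖ ≤ R}.Finite := fun R => by
    refine ((hx.finite_active hro hα hs R).union (hx.finite_active hro hα ht R)).subset ?_
    rintro n ⟨h | h, hR⟩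
    · exact Or.inl ⟨h, hR⟩
    · exact Or.inr ⟨h, hR⟩
  let F : ℕ → Finset ℕ := fun k => (hfin k).toFinset
  have hF : Monotone F := fun i j hij => by
    simp only [F, Set.Finite.toFinset_subset_toFinset]
    exact fun n hn => ⟨hn.1, hn.2.trans (by exact_mod_cast hij)⟩
  have hcov : ∀ n, (c n ≠ 0 ∨ d n ≠ 0) → ∃ k, n ∈ F k := fun n hn => by
    obtain ⟨k, hk⟩ := exists_nat_ge ‖(x n).1‖
    exact ⟨k, by simpa [F] using ⟨hn, hk⟩⟩
  have hlim : ∀ {t : ℝ} (_ : t ∈ Set.Icc 0 T1)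
      (_ : ∀ n, readerWeight T α ro t (x n) ≠ 0 → c n ≠ 0 ∨ d n ≠ 0), ∀ᵐ m ∂(markLaw M),
      Tendsto (fun k => ∑ n ∈ F k, (readerWeight T α ro t (x n) : ℂ) * m.2 n) atTop
        (𝓝 (limUnder atTop fun k : ℕ => interferenceWithin T α ro k t x m.2)) := by
    intro t ht hsub
    filter_upwards [hx.ae_exists_tendsto hM hro hα ht] with m ⟨l, hl⟩
    have h1 : Tendsto (fun k : ℕ => interferenceWithin T α ro k t x m.2) atTop (𝓝 l) :=
      hl.comp tendsto_natCast_atTop_atTop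
    refine (tendsto_nhds_limUnder ⟨l, h1⟩).congr fun k => ?_
    refine tsum_indicator_eq_sum (A := {n | c n ≠ 0 ∨ d n ≠ 0}) (r := fun n => ‖(x n).1‖)
      (hfin k) fun n hn => ?_
    have : readerWeight T α ro t (x n) = 0 := by
      by_contra h
      exact hn (hsub n h)
    simp [this]
  obtain ⟨i1, i2, e1, e2⟩ := integral_norm_sq_mul_norm_sq_of_tendsto
    (Q := markLaw M) (μ := coefficientLaw M) (μe := phaseLaw) (e := fun m => m.1)
    (hasCircularMoments_coefficientLaw hM) (Z := fun n m => m.2 n) (fun n => by fun_prop)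
    (hasLaw_coefficient_markLaw M) (iIndepFun_coefficient_markLaw M) hasCircularMoments_phaseLaw
    (hasLaw_fst_markLaw M) (indepFun_markLaw M) hcs hds hF (fun n h => hcov n (Or.inl h))
    (fun n h => hcov n (Or.inr h)) (hlim hs fun n h => Or.inl h) (hlim ht fun n h => Or.inr h) a
  simp only [normalizedSignal]
  constructor
  · rw [← ofReal_integral_eq_lintegral_ofReal i1 (.of_forall fun m => by positivity)]
    rw [e1, ENNReal.ofReal_add (tsum_nonneg fun n => sq_nonneg _) (sq_nonneg _),
      ENNReal.ofReal_tsum_of_nonneg (fun n => sq_nonneg _) hcs]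
  · simp_rw [← ENNReal.ofReal_mul (sq_nonneg ‖_ + _‖)]
    rw [← ofReal_integral_eq_lintegral_ofReal i2 (.of_forall fun m => by positivity)]
    have p1 : 0 ≤ ∑' n, c n ^ 2 := tsum_nonneg fun n => sq_nonneg _
    have p2 : 0 ≤ ∑' n, d n ^ 2 := tsum_nonneg fun n => sq_nonneg _
    have p3 : 0 ≤ ∑' n, c n * d n := tsum_nonneg fun n => mul_nonneg (hc0 n) (hd0 n)
    have p4 := sq_nonneg a
    rw [e2, ENNReal.ofReal_add (by positivity) (by positivity),
      ENNReal.ofReal_add (by positivity) (by positivity), ENNReal.ofReal_mul (by positivity),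
      ENNReal.ofReal_add p1 p4, ENNReal.ofReal_add p2 p4, ENNReal.ofReal_pow p3,
      ENNReal.ofReal_mul (by positivity), ENNReal.ofReal_mul (by positivity),
      ENNReal.ofReal_tsum_of_nonneg (fun n => sq_nonneg _) hcs,
      ENNReal.ofReal_tsum_of_nonneg (fun n => sq_nonneg _) hds,
      ENNReal.ofReal_tsum_of_nonneg (fun n => mul_nonneg (hc0 n) (hd0 n)) hcd,
      ENNReal.ofReal_ofNat]

end HasFinitePower

end Configuration

/-! ### Integrals over the plane and over pairs of times -/

section Integrals

/-- The value of `∫ max(‖x‖, ro)^(-β) dx` over the plane, for `β > 2`. -/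
def pathLossIntegral (β ro : ℝ) : ℝ := Real.pi * ro ^ (2 - β) * (β / (β - 2))

lemma pathLossIntegral_nonneg {β ro : ℝ} (hβ : 2 < β) (hro : 0 < ro) :
    0 ≤ pathLossIntegral β ro := by
  have h1 : 0 < β - 2 := by linarith
  have h2 : 0 < β := by linarith
  have := Real.pi_pos
  unfold pathLossIntegral
  positivity

lemma lintegral_max_norm_rpow {β ro : ℝ} (hβ : 2 < β) (hro : 0 < ro) :
    ∫⁻ x : Plane, ENNReal.ofReal (max ‖x‖ ro ^ (-β)) = ENNReal.ofReal (pathLossIntegral β ro) := by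
  have hunion : Set.Ioi (0 : ℝ) = Set.Ioc 0 ro ∪ Set.Ioi ro := (Set.Ioc_union_Ioi_eq_Ioi hro.le).symm
  have hdim : Module.finrank ℝ Plane - 1 = 1 := by simp
  have c1 : Set.EqOn (fun y : ℝ => y * max y ro ^ (-β)) (fun y => y * ro ^ (-β)) (Set.Ioc 0 ro) :=
    fun y hy => by simp only [max_eq_right hy.2]
  have c2 : Set.EqOn (fun y : ℝ => y * max y ro ^ (-β)) (fun y => y ^ (1 - β)) (Set.Ioi ro) :=
    fun y hy => by
      have hy0 : 0 < y := hro.trans hy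
      simp only [max_eq_left (le_of_lt (show ro < y from hy))]
      rw [sub_eq_add_neg, Real.rpow_add hy0, Real.rpow_one]
  have i1 : IntegrableOn (fun y : ℝ => y * max y ro ^ (-β)) (Set.Ioc 0 ro) := by
    rw [integrableOn_congr_fun c1 measurableSet_Ioc]
    exact ((continuous_id.mul continuous_const).integrableOn_Icc (a := 0) (b := ro)).mono_set
      Set.Ioc_subset_Icc_self
  have i2 : IntegrableOn (fun y : ℝ => y * max y ro ^ (-β)) (Set.Ioi ro) := by
    rw [integrableOn_congr_fun c2 measurableSet_Ioi]
    exact integrableOn_Ioi_rpow_of_lt (by linarith) hro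
  have hint : Integrable (fun x : Plane => max ‖x‖ ro ^ (-β)) := by
    have := integrable_fun_norm_addHaar (volume : Measure Plane) (f := fun y => max y ro ^ (-β))
    rw [this, hdim, hunion]
    simpa using i1.union i2
  rw [← ofReal_integral_eq_lintegral_ofReal hint
    (.of_forall fun x => Real.rpow_nonneg (hro.le.trans (le_max_right _ _)) _)]
  congr 1
  have h := integral_fun_norm_addHaar (volume : Measure Plane) (fun y => max y ro ^ (-β))
  rw [h, hdim, hunion]
  have hball : (volume : Measure Plane).real (Metric.ball 0 1) = Real.pi := by
    rw [Measure.real, EuclideanSpace.volume_ball_fin_two]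
    simp [Real.pi_pos.le]
  simp only [pow_one, smul_eq_mul, hball]
  rw [setIntegral_union (Set.Ioc_disjoint_Ioi le_rfl) measurableSet_Ioi i1 i2,
    setIntegral_congr_fun measurableSet_Ioc c1, setIntegral_congr_fun measurableSet_Ioi c2,
    integral_Ioi_rpow_of_lt (by linarith) hro, ← intervalIntegral.integral_of_le hro.le,
    intervalIntegral.integral_mul_const, integral_id, pathLossIntegral]
  have e1 : ro ^ (-β) = ro ^ (2 - β) / ro ^ 2 := by
    rw [← Real.rpow_natCast, ← Real.rpow_sub hro]; congr 1; push_cast; ring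
  have e2 : (1 : ℝ) - β + 1 = 2 - β := by ring
  have h1 : β - 2 ≠ 0 := by linarith
  have h2 : (2 : ℝ) - β ≠ 0 := by linarith
  have h3 : (2 : ℝ) - β = -(β - 2) := by ring
  rw [e1, e2]
  generalize ro ^ (2 - β) = y
  rw [h3]
  simp
  field_simp
  ring

/-- The intensity integral of a function that is supported in the time interval `[a, b]`.
For `b < a` both sides vanish. -/
lemma lintegral_window {β ro lam a b : ℝ} (hβ : 2 < β) (hro : 0 < ro) (hlam : 0 ≤ lam) :
    ∫⁻ p : Plane × ℝ, ENNReal.ofReal (if a ≤ p.2 ∧ p.2 ≤ b then max ‖p.1‖ ro ^ (-β) else 0)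
      ∂(ENNReal.ofReal lam • volume) =
      ENNReal.ofReal (lam * (b - a) * pathLossIntegral β ro) := by
  have e : ∀ p : Plane × ℝ,
      ENNReal.ofReal (if a ≤ p.2 ∧ p.2 ≤ b then max ‖p.1‖ ro ^ (-β) else 0) =
      ENNReal.ofReal (max ‖p.1‖ ro ^ (-β)) *
        (Set.Icc a b).indicator (1 : ℝ → ENNReal) p.2 := fun p => by
    by_cases h : a ≤ p.2 ∧ p.2 ≤ b
    · rw [if_pos h, Set.indicator_of_mem (show p.2 ∈ Set.Icc a b from h)]; simp
    · rw [if_neg h, Set.indicator_of_notMem (show p.2 ∉ Set.Icc a b from h)]; simp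
  rw [lintegral_smul_measure, Measure.volume_eq_prod]
  simp_rw [e]
  rw [lintegral_prod_mul (f := fun x : Plane => ENNReal.ofReal (max ‖x‖ ro ^ (-β)))
    (g := (Set.Icc a b).indicator (1 : ℝ → ENNReal)) (Measurable.aemeasurable (by fun_prop))
    (measurable_one.indicator measurableSet_Icc).aemeasurable, lintegral_max_norm_rpow hβ hro,
    lintegral_indicator_one measurableSet_Icc, Real.volume_Icc, smul_eq_mul,
    ← ENNReal.ofReal_mul (pathLossIntegral_nonneg hβ hro), ← ENNReal.ofReal_mul hlam]
  congr 1; ring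

/-- Two activity windows overlap in a window of length `T - |s - t|`. -/
lemma readerWeight_mul {T α ro s t : ℝ} (hro : 0 < ro) (p : Plane × ℝ) :
    readerWeight T α ro s p * readerWeight T α ro t p =
      if max s t - T ≤ p.2 ∧ p.2 ≤ min s t then max ‖p.1‖ ro ^ (-α) else 0 := by
  have hm : 0 < max ‖p.1‖ ro := hro.trans_le (le_max_right _ _)
  have hiff : max s t - T ≤ p.2 ∧ p.2 ≤ min s t ↔
      (p.2 ≤ s ∧ s ≤ p.2 + T) ∧ (p.2 ≤ t ∧ t ≤ p.2 + T) := by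
    rw [sub_le_iff_le_add, max_le_iff, le_min_iff]; tauto
  unfold readerWeight
  by_cases h1 : p.2 ≤ s ∧ s ≤ p.2 + T
  · by_cases h2 : p.2 ≤ t ∧ t ≤ p.2 + T
    · rw [if_pos h1, if_pos h2, if_pos (hiff.2 ⟨h1, h2⟩), ← Real.rpow_add hm]
      congr 1; ring
    · rw [if_neg h2, if_neg fun h => h2 (hiff.1 h).2, mul_zero]
  · rw [if_neg h1, if_neg fun h => h1 (hiff.1 h).1, zero_mul]

/-- If `|s - t| > T`, no reader is active at both times, and both sides vanish. -/
lemma lintegral_readerWeight_mul {T α ro lam s t : ℝ} (hα : 2 < α) (hro : 0 < ro) (hlam : 0 ≤ lam) :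
    ∫⁻ p, ENNReal.ofReal (readerWeight T α ro s p * readerWeight T α ro t p)
      ∂(ENNReal.ofReal lam • volume) =
      ENNReal.ofReal (lam * (T - |s - t|) * pathLossIntegral α ro) := by
  have h := max_sub_min_eq_abs s t
  simp_rw [readerWeight_mul hro]
  rw [lintegral_window hα hro hlam, abs_sub_comm, ← h]
  congr 3; ring

lemma lintegral_readerWeight_sq {T α ro lam t : ℝ} (hα : 2 < α) (hro : 0 < ro) (hlam : 0 ≤ lam) :
    ∫⁻ p, ENNReal.ofReal (readerWeight T α ro t p ^ 2) ∂(ENNReal.ofReal lam • volume) =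
      ENNReal.ofReal (lam * T * pathLossIntegral α ro) := by
  simp_rw [pow_two]
  rw [lintegral_readerWeight_mul hα hro hlam]
  simp

/-- The squares of the amplitudes double the path-loss exponent. -/
lemma lintegral_readerWeight_mul_sq {T α ro lam s t : ℝ} (hα : 2 < α) (hro : 0 < ro)
    (hlam : 0 ≤ lam) :
    ∫⁻ p, ENNReal.ofReal ((readerWeight T α ro s p * readerWeight T α ro t p) ^ 2)
      ∂(ENNReal.ofReal lam • volume) =
      ENNReal.ofReal (lam * (T - |s - t|) * pathLossIntegral (2 * α) ro) := by
  rw [← lintegral_readerWeight_mul (by linarith) hro hlam]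
  congr with p
  congr 1
  rw [readerWeight_mul hro, readerWeight_mul hro]
  split_ifs
  · rw [pow_two, ← Real.rpow_add (hro.trans_le (le_max_right _ _))]
    congr 1; ring
  · simp

lemma lintegral_windowWeight_sq_ne_top {T T1 α ro lam : ℝ} (hα : 2 < α) (hro : 0 < ro)
    (hlam : 0 ≤ lam) :
    ∫⁻ p, ENNReal.ofReal (windowWeight T T1 α ro p ^ 2) ∂(ENNReal.ofReal lam • volume) ≠ ⊤ := by
  have e : ∀ p : Plane × ℝ, windowWeight T T1 α ro p ^ 2 =
      if -T ≤ p.2 ∧ p.2 ≤ T1 then max ‖p.1‖ ro ^ (-α) else 0 := fun p => by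
    unfold windowWeight
    split_ifs
    · rw [pow_two, ← Real.rpow_add (hro.trans_le (le_max_right _ _))]
      congr 1; ring
    · simp
  simp_rw [e]
  rw [lintegral_window hα hro hlam]
  exact ENNReal.ofReal_ne_top

lemma intervalIntegral_quadratic (a b c₀ c₁ c₂ : ℝ) :
    ∫ x in a..b, (c₀ + c₁ * x + c₂ * x ^ 2) =
      c₀ * (b - a) + c₁ * (b ^ 2 - a ^ 2) / 2 + c₂ * (b ^ 3 - a ^ 3) / 3 := by
  have h : ∀ x ∈ Set.uIcc a b, HasDerivAt
      (fun x : ℝ => c₀ * x + c₁ * (x ^ 2 / 2) + c₂ * (x ^ 3 / 3)) (c₀ + c₁ * x + c₂ * x ^ 2) x := by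
    intro x _
    have h2 := (hasDerivAt_pow 2 x).div_const 2
    have h3 := (hasDerivAt_pow 3 x).div_const 3
    exact ((((hasDerivAt_id' x).const_mul c₀).fun_add (h2.const_mul c₁)).fun_add
      (h3.const_mul c₂)).congr_deriv (by norm_num)
  rw [intervalIntegral.integral_eq_sub_of_hasDerivAt h
    (Continuous.intervalIntegrable (by fun_prop) _ _)]
  ring

lemma setLIntegral_Icc_ofReal {f : ℝ → ℝ} (hf : Continuous f) {b : ℝ} (hb : 0 ≤ b)
    (h0 : ∀ x ∈ Set.Icc 0 b, 0 ≤ f x) :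
    ∫⁻ x in Set.Icc 0 b, ENNReal.ofReal (f x) = ENNReal.ofReal (∫ x in (0 : ℝ)..b, f x) := by
  rw [intervalIntegral.integral_of_le hb, ← integral_Icc_eq_integral_Ioc,
    ofReal_integral_eq_lintegral_ofReal hf.integrableOn_Icc
      ((ae_restrict_iff' measurableSet_Icc).2 (.of_forall h0))]

/-- The inner integral is split at `t = s`, where `|s - t|` changes its form. -/
lemma lintegral_lintegral_overlap {A B C T T1 : ℝ} (hA : 0 ≤ A) (hB : 0 ≤ B) (hC : 0 ≤ C)
    (hT1 : 0 ≤ T1) (hT : T1 ≤ T) :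
    ∫⁻ s in Set.Icc 0 T1, ∫⁻ t in Set.Icc 0 T1,
        ENNReal.ofReal (A + B * (T - |s - t|) + C * (T - |s - t|) ^ 2) =
      ENNReal.ofReal (T1 ^ 2 *
        (A + B * (T - T1 / 3) + C * (T ^ 2 - 2 / 3 * T * T1 + T1 ^ 2 / 6))) := by
  have hnn : ∀ s ∈ Set.Icc 0 T1, ∀ t ∈ Set.Icc 0 T1,
      0 ≤ A + B * (T - |s - t|) + C * (T - |s - t|) ^ 2 := fun s hs t ht => by
    have : |s - t| ≤ T1 := abs_sub_le_of_nonneg_of_le hs.1 hs.2 ht.1 ht.2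
    have h1 : 0 ≤ T - |s - t| := by linarith
    positivity
  have inner : ∀ s ∈ Set.Icc 0 T1,
      ∫ t in (0 : ℝ)..T1, (A + B * (T - |s - t|) + C * (T - |s - t|) ^ 2) =
      (A * T1 + B * (T * T1 - T1 ^ 2 / 2) + C * (T ^ 2 * T1 - T * T1 ^ 2 + T1 ^ 3 / 3)) +
        (B * T1 + C * (2 * T * T1 - T1 ^ 2)) * s + (-B + C * (T1 - 2 * T)) * s ^ 2 := by
    intro s hs
    have hcont : Continuous fun t => A + B * (T - |s - t|) + C * (T - |s - t|) ^ 2 := by fun_prop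
    rw [← intervalIntegral.integral_add_adjacent_intervals (b := s)
      (hcont.intervalIntegrable _ _) (hcont.intervalIntegrable _ _)]
    have e1 : ∫ t in (0 : ℝ)..s, (A + B * (T - |s - t|) + C * (T - |s - t|) ^ 2) =
        ∫ t in (0 : ℝ)..s, ((A + B * (T - s) + C * (T - s) ^ 2) + (B + 2 * C * (T - s)) * t +
          C * t ^ 2) := by
      refine intervalIntegral.integral_congr fun t ht => ?_
      rw [Set.uIcc_of_le hs.1] at ht
      simp only [abs_of_nonneg (sub_nonneg.2 ht.2)]
      ring
    have e2 : ∫ t in s..T1, (A + B * (T - |s - t|) + C * (T - |s - t|) ^ 2) =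
        ∫ t in s..T1, ((A + B * (T + s) + C * (T + s) ^ 2) + (-B - 2 * C * (T + s)) * t +
          C * t ^ 2) := by
      refine intervalIntegral.integral_congr fun t ht => ?_
      rw [Set.uIcc_of_le hs.2] at ht
      simp only [abs_of_nonpos (sub_nonpos.2 ht.1)]
      ring
    rw [e1, e2, intervalIntegral_quadratic, intervalIntegral_quadratic]
    ring
  have hcont2 : Continuous fun s : ℝ =>
      (A * T1 + B * (T * T1 - T1 ^ 2 / 2) + C * (T ^ 2 * T1 - T * T1 ^ 2 + T1 ^ 3 / 3)) +
        (B * T1 + C * (2 * T * T1 - T1 ^ 2)) * s + (-B + C * (T1 - 2 * T)) * s ^ 2 := by fun_prop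
  rw [setLIntegral_congr_fun measurableSet_Icc fun s hs =>
    (setLIntegral_Icc_ofReal (by fun_prop) hT1 (hnn s hs)).trans
      (congrArg ENNReal.ofReal (inner s hs)), setLIntegral_Icc_ofReal hcont2 hT1 fun s hs => ?_,
    intervalIntegral_quadratic]
  · congr 1; ring
  · rw [← inner s hs]
    exact intervalIntegral.integral_nonneg hT1 fun t ht => hnn s hs t ht

end Integrals

/-! ### Moments of the energy -/

section Energy

open scoped ENNReal

variable {Ω : Type*} [MeasurableSpace Ω] {P : Measure Ω}

lemma measurableSet_hasFinitePower (T T1 α ro : ℝ) :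
    MeasurableSet {x : ℕ → Plane × ℝ | HasFinitePower T T1 α ro x} := by
  have h : Measurable fun x : ℕ → Plane × ℝ =>
      ∑' n, ENNReal.ofReal (windowWeight T T1 α ro (x n) ^ 2) :=
    Measurable.tsum fun n => (((measurable_windowWeight T T1 α ro).comp
      (measurable_pi_apply n)).pow_const 2).ennreal_ofReal
  exact (h (measurableSet_singleton ⊤)).compl

instance sigmaFinite_ofReal_smul_volume (lam : ℝ) :
    SigmaFinite (ENNReal.ofReal lam • (volume : Measure (Plane × ℝ))) :=
  inferInstanceAs (SigmaFinite (lam.toNNReal • (volume : Measure (Plane × ℝ))))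

section Poisson

variable {X : ℕ → Ω → Plane × ℝ} {lam T T1 α ro : ℝ} {M : ℕ}

lemma IsPoissonPointProcess.ae_hasFinitePower
    (hX : IsPoissonPointProcess X (ENNReal.ofReal lam • volume) P) (hlam : 0 ≤ lam) (hα : 2 < α)
    (hro : 0 < ro) :
    ∀ᵐ x ∂(P.map fun ω n => X n ω), HasFinitePower T T1 α ro x := by
  have hm : Measurable fun ω n => X n ω := measurable_pi_iff.2 hX.measurable
  rw [ae_map_iff hm.aemeasurable (measurableSet_hasFinitePower T T1 α ro)]
  have hf : Measurable fun p => ENNReal.ofReal (windowWeight T T1 α ro p ^ 2) :=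
    ((measurable_windowWeight T T1 α ro).pow_const 2).ennreal_ofReal
  -- a sum of finite mean is almost surely finite
  have h := lintegral_windowWeight_sq_ne_top (T := T) (T1 := T1) hα hro hlam
  rw [← hX.lintegral_tsum_eq hf] at h
  filter_upwards [ae_lt_top (hX.measurable_tsum hf) h] with ω hω using hω.ne

/-- The power of the normalized signal, for the configuration `c`. -/
def signalPower (T α ro a t : ℝ) (c : (ℕ → Plane × ℝ) × ℂ × (ℕ → ℂ)) : ℝ≥0∞ :=
  ENNReal.ofReal (‖normalizedSignal T α ro a t c‖ ^ 2)

lemma measurable_signalPower (T α ro a : ℝ) :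
    Measurable fun p : ℝ × ((ℕ → Plane × ℝ) × ℂ × (ℕ → ℂ)) => signalPower T α ro a p.1 p.2 :=
  ((stronglyMeasurable_normalizedSignal T α ro a).norm.measurable.pow_const 2).ennreal_ofReal

lemma measurable_signalPower_right (T α ro a t : ℝ) : Measurable (signalPower T α ro a t) :=
  Measurable.of_uncurry_left (f := signalPower T α ro a) (measurable_signalPower T α ro a)

lemma measurable_signalPower_left (T α ro a : ℝ) (c : (ℕ → Plane × ℝ) × ℂ × (ℕ → ℂ)) :
    Measurable fun t => signalPower T α ro a t c :=
  Measurable.of_uncurry_right (f := signalPower T α ro a) (measurable_signalPower T α ro a)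

variable [IsProbabilityMeasure P]

lemma lintegral_signalPower
    (hX : IsPoissonPointProcess X (ENNReal.ofReal lam • volume) P) (hM : 1 ≤ M) (hlam : 0 ≤ lam)
    (hα : 2 < α) (hro : 0 < ro) (hT : 0 ≤ T) {t : ℝ} (ht : t ∈ Set.Icc 0 T1) (a : ℝ) :
    ∫⁻ c, signalPower T α ro a t c ∂((P.map fun ω n => X n ω).prod (markLaw M)) =
      ENNReal.ofReal (lam * T * pathLossIntegral α ro + a ^ 2) := by
  have hm : Measurable fun ω n => X n ω := measurable_pi_iff.2 hX.measurable
  have hT1 : 0 ≤ T1 := ht.1.trans ht.2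
  have hw : Measurable fun p => ENNReal.ofReal (readerWeight T α ro t p ^ 2) :=
    (((measurable_readerWeight T α ro).comp measurable_prodMk_left).pow_const 2).ennreal_ofReal
  have hsum := hX.measurable_tsum hw
  have hJ := pathLossIntegral_nonneg hα hro
  rw [lintegral_prod _ (measurable_signalPower_right T α ro a t).aemeasurable]
  unfold signalPower
  rw [lintegral_congr_ae ((hX.ae_hasFinitePower hlam hα hro).mono fun x hx =>
      (hx.lintegral_normalizedSignal hM hro (by linarith) ht ht a).1),
    lintegral_map ?_ hm, lintegral_add_right _ measurable_const, hX.lintegral_tsum_eq hw,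
    lintegral_readerWeight_sq hα hro hlam, lintegral_const, measure_univ, mul_one,
    ENNReal.ofReal_add (by positivity) (by positivity)]
  exact (Measurable.tsum fun n => hw.comp (measurable_pi_apply n)).add_const _

/-- The covariance structure of the power, which depends on the times through their distance. -/
lemma lintegral_signalPower_mul_signalPower
    (hX : IsPoissonPointProcess X (ENNReal.ofReal lam • volume) P) (hM : 1 ≤ M) (hlam : 0 ≤ lam)
    (hα : 2 < α) (hro : 0 < ro) (hT : T1 ≤ T) {s t : ℝ} (hs : s ∈ Set.Icc 0 T1)
    (ht : t ∈ Set.Icc 0 T1) (a : ℝ) :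
    ∫⁻ c, signalPower T α ro a s c * signalPower T α ro a t c
        ∂((P.map fun ω n => X n ω).prod (markLaw M)) =
      ENNReal.ofReal ((lam * T * pathLossIntegral α ro + a ^ 2) ^ 2 +
        (2 * lam * pathLossIntegral (2 * α) ro + 2 * a ^ 2 * (lam * pathLossIntegral α ro)) *
          (T - |s - t|) + (lam * pathLossIntegral α ro) ^ 2 * (T - |s - t|) ^ 2) := by
  have hm : Measurable fun ω n => X n ω := measurable_pi_iff.2 hX.measurable
  have hT1 : 0 ≤ T1 := ht.1.trans ht.2
  have hT0 : 0 ≤ T := hT1.trans hT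
  have hst : |s - t| ≤ T := (abs_sub_le_of_nonneg_of_le hs.1 hs.2 ht.1 ht.2).trans hT
  have hr : ∀ t, Measurable (readerWeight T α ro t) := fun t =>
    (measurable_readerWeight T α ro).comp measurable_prodMk_left
  set fs : Plane × ℝ → ℝ≥0∞ := fun p => ENNReal.ofReal (readerWeight T α ro s p ^ 2) with hfs
  set ft : Plane × ℝ → ℝ≥0∞ := fun p => ENNReal.ofReal (readerWeight T α ro t p ^ 2) with hft
  set fst : Plane × ℝ → ℝ≥0∞ := fun p =>
    ENNReal.ofReal (readerWeight T α ro s p * readerWeight T α ro t p) with hfst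
  have ms : Measurable fs := ((hr s).pow_const 2).ennreal_ofReal
  have mt : Measurable ft := ((hr t).pow_const 2).ennreal_ofReal
  have mst : Measurable fst := ((hr s).mul (hr t)).ennreal_ofReal
  set A := ENNReal.ofReal (a ^ 2) with hA
  set K₀ := lam * T * pathLossIntegral α ro with hK₀
  set K₁ := lam * (T - |s - t|) * pathLossIntegral α ro with hK₁
  set K₂ := lam * (T - |s - t|) * pathLossIntegral (2 * α) ro with hK₂
  have hJ := pathLossIntegral_nonneg hα hro
  have hJ2 := pathLossIntegral_nonneg (β := 2 * α) (by linarith) hro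
  have hlag : 0 ≤ T - |s - t| := sub_nonneg.2 hst
  have h0 : 0 ≤ K₀ := by positivity
  have h1 : 0 ≤ K₁ := by positivity
  have h2 : 0 ≤ K₂ := by positivity
  have es : ∫⁻ p, fs p ∂(ENNReal.ofReal lam • volume) = ENNReal.ofReal K₀ :=
    lintegral_readerWeight_sq hα hro hlam
  have et : ∫⁻ p, ft p ∂(ENNReal.ofReal lam • volume) = ENNReal.ofReal K₀ :=
    lintegral_readerWeight_sq hα hro hlam
  have est : ∫⁻ p, fst p ∂(ENNReal.ofReal lam • volume) = ENNReal.ofReal K₁ :=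
    lintegral_readerWeight_mul hα hro hlam
  have efg : ∫⁻ p, fs p * ft p ∂(ENNReal.ofReal lam • volume) = ENNReal.ofReal K₂ := by
    rw [hK₂, ← lintegral_readerWeight_mul_sq hα hro hlam]
    congr with p
    rw [mul_pow, ENNReal.ofReal_mul (sq_nonneg _)]
  have eff : ∫⁻ p, fst p * fst p ∂(ENNReal.ofReal lam • volume) = ENNReal.ofReal K₂ := by
    rw [hK₂, ← lintegral_readerWeight_mul_sq hα hro hlam]
    congr with p
    rw [pow_two, ENNReal.ofReal_mul (mul_nonneg (readerWeight_nonneg hro.le p)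
      (readerWeight_nonneg hro.le p))]
  have e : ∀ x : ℕ → Plane × ℝ, ((∑' n, fs (x n)) + A) * ((∑' n, ft (x n)) + A) +
      (∑' n, fst (x n)) ^ 2 + 2 * A * ∑' n, fst (x n) =
      (∑' n, fs (x n)) * (∑' n, ft (x n)) + A * (∑' n, fs (x n)) + A * (∑' n, ft (x n)) + A * A +
      (∑' n, fst (x n)) * (∑' n, fst (x n)) + 2 * A * ∑' n, fst (x n) := fun x => by ring
  have gs := hX.measurable_tsum ms
  have gt := hX.measurable_tsum mt
  have gst := hX.measurable_tsum mst
  have hpi : ∀ {f : Plane × ℝ → ℝ≥0∞}, Measurable f →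
      Measurable fun x : ℕ → Plane × ℝ => ∑' n, f (x n) := fun hf =>
    Measurable.tsum fun n => hf.comp (measurable_pi_apply n)
  have qs := hpi ms
  have qt := hpi mt
  have qst := hpi mst
  rw [lintegral_prod _ ((measurable_signalPower_right T α ro a s).fun_mul
      (measurable_signalPower_right T α ro a t)).aemeasurable]
  unfold signalPower
  rw [lintegral_congr_ae ((hX.ae_hasFinitePower hlam hα hro).mono fun x hx =>
      ((hx.lintegral_normalizedSignal hM hro (by linarith) hs ht a).2.trans (e x))),
    lintegral_map (by fun_prop) hm, lintegral_add_left (by fun_prop),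
    lintegral_add_left (by fun_prop), lintegral_add_left (by fun_prop),
    lintegral_add_left (by fun_prop), lintegral_add_left (by fun_prop),
    hX.lintegral_tsum_mul_tsum ms mt, hX.lintegral_tsum_mul_tsum mst mst,
    lintegral_const_mul _ gs, lintegral_const_mul _ gt, lintegral_const_mul _ gst,
    hX.lintegral_tsum_eq ms, hX.lintegral_tsum_eq mt, hX.lintegral_tsum_eq mst,
    lintegral_const, measure_univ, mul_one, es, et, est, efg, eff, hA]
  rw [show (K₀ + a ^ 2) ^ 2 + (2 * lam * pathLossIntegral (2 * α) ro +
      2 * a ^ 2 * (lam * pathLossIntegral α ro)) * (T - |s - t|) +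
      (lam * pathLossIntegral α ro) ^ 2 * (T - |s - t|) ^ 2 =
      (K₀ * K₀ + K₂) + a ^ 2 * K₀ + a ^ 2 * K₀ + a ^ 2 * a ^ 2 + (K₁ * K₁ + K₂) +
      2 * a ^ 2 * K₁ by simp only [hK₁, hK₂]; ring]
  have ha := sq_nonneg a
  clear_value K₀ K₁ K₂
  repeat rw [ENNReal.ofReal_add (by positivity) (by positivity)]
  repeat rw [ENNReal.ofReal_mul (by positivity)]
  rw [ENNReal.ofReal_ofNat]

/-- The energy of the normalized signal over `[0, T1]`, for the configuration `c`. -/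
def signalEnergy (T T1 α ro a : ℝ) (c : (ℕ → Plane × ℝ) × ℂ × (ℕ → ℂ)) : ℝ≥0∞ :=
  ∫⁻ t in Set.Icc 0 T1, signalPower T α ro a t c

lemma measurable_signalEnergy (T T1 α ro a : ℝ) : Measurable (signalEnergy T T1 α ro a) :=
  Measurable.lintegral_prod_left (f := signalPower T α ro a) (measurable_signalPower T α ro a)

lemma lintegral_signalEnergy
    (hX : IsPoissonPointProcess X (ENNReal.ofReal lam • volume) P) (hM : 1 ≤ M) (hlam : 0 ≤ lam)
    (hα : 2 < α) (hro : 0 < ro) (hT : 0 ≤ T) (hT1 : 0 ≤ T1) (a : ℝ) :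
    ∫⁻ c, signalEnergy T T1 α ro a c ∂((P.map fun ω n => X n ω).prod (markLaw M)) =
      ENNReal.ofReal (T1 * (lam * T * pathLossIntegral α ro + a ^ 2)) := by
  have hm : Measurable fun ω n => X n ω := measurable_pi_iff.2 hX.measurable
  have := Measure.isProbabilityMeasure_map (μ := P) hm.aemeasurable
  have hp := measurable_signalPower T α ro a
  unfold signalEnergy
  rw [lintegral_lintegral_swap (f := fun c t => signalPower T α ro a t c)
      (hp.comp measurable_swap).aemeasurable,
    setLIntegral_congr_fun measurableSet_Icc fun t ht =>
      lintegral_signalPower hX hM hlam hα hro hT ht a,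
    setLIntegral_const, Real.volume_Icc, sub_zero, ← ENNReal.ofReal_mul' hT1, mul_comm]

/-- The square of the energy is a double integral over pairs of times, with which the expectation
is exchanged. -/
lemma lintegral_signalEnergy_sq
    (hX : IsPoissonPointProcess X (ENNReal.ofReal lam • volume) P) (hM : 1 ≤ M) (hlam : 0 ≤ lam)
    (hα : 2 < α) (hro : 0 < ro) (hT1 : 0 ≤ T1) (hT : T1 ≤ T) (a : ℝ) :
    ∫⁻ c, signalEnergy T T1 α ro a c ^ 2 ∂((P.map fun ω n => X n ω).prod (markLaw M)) =
      ENNReal.ofReal (T1 ^ 2 * ((lam * T * pathLossIntegral α ro + a ^ 2) ^ 2 +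
        (2 * lam * pathLossIntegral (2 * α) ro + 2 * a ^ 2 * (lam * pathLossIntegral α ro)) *
          (T - T1 / 3) +
        (lam * pathLossIntegral α ro) ^ 2 * (T ^ 2 - 2 / 3 * T * T1 + T1 ^ 2 / 6))) := by
  have hm : Measurable fun ω n => X n ω := measurable_pi_iff.2 hX.measurable
  have := Measure.isProbabilityMeasure_map (μ := P) hm.aemeasurable
  have hp := measurable_signalPower T α ro a
  have hJ := pathLossIntegral_nonneg hα hro
  have hJ2 := pathLossIntegral_nonneg (β := 2 * α) (by linarith) hro
  have e : ∀ c, signalEnergy T T1 α ro a c ^ 2 = ∫⁻ s in Set.Icc 0 T1,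
      signalPower T α ro a s c * signalEnergy T T1 α ro a c := fun c => by
    rw [lintegral_mul_const _ (measurable_signalPower_left T α ro a c), pow_two, signalEnergy]
  have hE := measurable_signalEnergy T T1 α ro a
  simp_rw [e]
  rw [lintegral_lintegral_swap
      (f := fun c s => signalPower T α ro a s c * signalEnergy T T1 α ro a c) (((hp.comp measurable_swap).mul
      (hE.comp measurable_fst)).aemeasurable),
    ← lintegral_lintegral_overlap (by positivity) (by positivity) (by positivity) hT1 hT]
  refine setLIntegral_congr_fun measurableSet_Icc fun s hs => ?_
  have e2 : ∀ c, signalPower T α ro a s c * signalEnergy T T1 α ro a c =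
      ∫⁻ t in Set.Icc 0 T1, signalPower T α ro a s c * signalPower T α ro a t c := fun c => by
    rw [lintegral_const_mul _ (measurable_signalPower_left T α ro a c), signalEnergy]
  simp_rw [e2]
  rw [lintegral_lintegral_swap
      (f := fun c t => signalPower T α ro a s c * signalPower T α ro a t c)
      (((measurable_signalPower_right T α ro a s).comp measurable_fst).mul
        (hp.comp measurable_swap)).aemeasurable]
  exact setLIntegral_congr_fun measurableSet_Icc fun t ht =>
    lintegral_signalPower_mul_signalPower hX hM hlam hα hro hT hs ht a

end Poisson

/-- The mean and the variance of a random variable, from the moments of an extended nonnegative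
random variable of which it is a multiple. -/
lemma memLp_integral_variance_of_lintegral [IsProbabilityMeasure P] {F : Ω → ℝ} {Q : Ω → ℝ≥0∞}
    {b m v : ℝ} (hQ : AEMeasurable Q P) (hF : F =ᵐ[P] fun ω => b * (Q ω).toReal)
    (hm : 0 ≤ m) (hv : 0 ≤ v) (h1 : ∫⁻ ω, Q ω ∂P = ENNReal.ofReal m)
    (h2 : ∫⁻ ω, Q ω ^ 2 ∂P = ENNReal.ofReal v) :
    MemLp F 2 P ∧ ∫ ω, F ω ∂P = b * m ∧ variance F P = b ^ 2 * (v - m ^ 2) := by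
  have hfin : ∀ᵐ ω ∂P, Q ω < ⊤ := ae_lt_top' hQ (by rw [h1]; exact ENNReal.ofReal_ne_top)
  have hfin2 : ∀ᵐ ω ∂P, Q ω ^ 2 < ⊤ := hfin.mono fun ω h => ENNReal.pow_lt_top h
  have hL : MemLp (fun ω => (Q ω).toReal) 2 P := by
    rw [memLp_two_iff_integrable_sq hQ.ennreal_toReal.aestronglyMeasurable]
    simp_rw [← ENNReal.toReal_pow]
    exact integrable_toReal_of_lintegral_ne_top (hQ.pow_const 2)
      (by rw [h2]; exact ENNReal.ofReal_ne_top)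
  have e1 : ∫ ω, (Q ω).toReal ∂P = m := by
    rw [integral_toReal hQ hfin, h1, ENNReal.toReal_ofReal hm]
  have e2 : ∫ ω, (Q ω).toReal ^ 2 ∂P = v := by
    simp_rw [← ENNReal.toReal_pow]
    rw [integral_toReal (hQ.pow_const 2) hfin2, h2, ENNReal.toReal_ofReal hv]
  refine ⟨(hL.const_mul b).ae_eq hF.symm, ?_, ?_⟩
  · rw [integral_congr_ae hF, integral_const_mul, e1]
  · rw [variance_congr hF, variance_const_mul, variance_eq_sub hL]
    simp only [Pi.pow_apply, e1, e2]

end Energy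

/-! ### Convergence of the signal and the harvested energy -/

section Convergence

variable {Ω : Type*} {M : ℕ} {lam T T1 α ro : ℝ}

/-- Convergence along rational radii is a measurable event, as Fubini's theorem requires. -/
lemma IsPoissonPointProcess.ae_exists_tendsto_rat [MeasurableSpace Ω] {P : Measure Ω}
    {X : ℕ → Ω → Plane × ℝ}
    (hX : IsPoissonPointProcess X (ENNReal.ofReal lam • volume) P) (hM : 1 ≤ M) (hlam : 0 ≤ lam)
    (hα : 2 < α) (hro : 0 < ro) {t : ℝ} (ht : t ∈ Set.Icc 0 T1) :
    ∀ᵐ c ∂((P.map fun ω n => X n ω).prod (markLaw M)), ∃ l, Tendsto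
      (fun q : ℚ => interferenceWithin T α ro q t c.1 c.2.2) atTop (𝓝 l) := by
  have hmeas : MeasurableSet {c : (ℕ → Plane × ℝ) × ℂ × (ℕ → ℂ) | ∃ l, Tendsto
      (fun q : ℚ => interferenceWithin T α ro q t c.1 c.2.2) atTop (𝓝 l)} :=
    measurable_prodMk_left (x := t) (measurableSet_exists_tendsto_rat T α ro)
  refine (Measure.ae_prod_iff_ae_ae hmeas).2 ?_
  filter_upwards [hX.ae_hasFinitePower (T := T) (T1 := T1) hlam hα hro] with x hx
  filter_upwards [hx.ae_exists_tendsto hM hro (by linarith) ht] with m ⟨l, hl⟩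
  exact ⟨l, hl.comp (tendsto_ratCast_atTop_iff.2 tendsto_id)⟩

lemma IsPoissonPointProcess.ae_ae_exists_tendsto_rat [MeasurableSpace Ω] {P : Measure Ω}
    [IsProbabilityMeasure P] {X : ℕ → Ω → Plane × ℝ}
    (hX : IsPoissonPointProcess X (ENNReal.ofReal lam • volume) P) (hM : 1 ≤ M) (hlam : 0 ≤ lam)
    (hα : 2 < α) (hro : 0 < ro) :
    ∀ᵐ c ∂((P.map fun ω n => X n ω).prod (markLaw M)), ∀ᵐ t ∂(volume.restrict (Set.Icc 0 T1)),
      ∃ l, Tendsto (fun q : ℚ => interferenceWithin T α ro q t c.1 c.2.2) atTop (𝓝 l) := by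
  have hm : Measurable fun ω n => X n ω := measurable_pi_iff.2 hX.measurable
  have := Measure.isProbabilityMeasure_map (μ := P) hm.aemeasurable
  rw [← Measure.ae_ae_comm (measurableSet_exists_tendsto_rat T α ro)]
  exact (ae_restrict_iff' measurableSet_Icc).2
    (.of_forall fun t ht => hX.ae_exists_tendsto_rat hM hlam hα hro ht)

/-- The limit that defines the signal exists, and the signal is a measurable function of the
configuration. -/
lemma TagEnvironment.tendsto_signalWithin (N : TagEnvironment Ω M) {PT : ℝ} (hPT : 0 ≤ PT)
    (G d0 : ℝ) (hro : 0 < ro) (hα : 0 ≤ α) {t : ℝ} (ht : t ∈ Set.Icc 0 T1) {ω : Ω}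
    (hx : HasFinitePower T T1 α ro fun n => N.reader n ω)
    (h : ∃ l, Tendsto (fun q : ℚ => interferenceWithin T α ro q t (fun n => N.reader n ω)
      fun n => N.coefficient n ω) atTop (𝓝 l)) :
    Tendsto (fun R : ℝ => N.signalWithin PT G d0 T α ro R t ω) atTop
        (𝓝 (N.signal PT G d0 T α ro t ω)) ∧
      N.signal PT G d0 T α ro t ω = ((Real.sqrt PT : ℝ) : ℂ) *
        normalizedSignal T α ro (Real.sqrt (G * d0 ^ (-α))) t (fun n => N.reader n ω,
          Complex.exp ((N.tagPhase ω : ℂ) * Complex.I), fun n => N.coefficient n ω) := by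
  obtain ⟨l, hl⟩ := hx.exists_tendsto_real_of_rat hro hα ht h
  have hS : Tendsto (fun R : ℝ => N.signalWithin PT G d0 T α ro R t ω) atTop
      (𝓝 (((Real.sqrt PT : ℝ) : ℂ) * (l + ((Real.sqrt (G * d0 ^ (-α)) : ℝ) : ℂ) *
        Complex.exp ((N.tagPhase ω : ℂ) * Complex.I)))) := by
    simp_rw [signalWithin_eq N hPT]
    exact (hl.add_const _).const_mul _
  have hk : Tendsto (fun k : ℕ => interferenceWithin T α ro k t (fun n => N.reader n ω)
      fun n => N.coefficient n ω) atTop (𝓝 l) := hl.comp tendsto_natCast_atTop_atTop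
  refine ⟨tendsto_nhds_limUnder ⟨_, hS⟩, ?_⟩
  rw [normalizedSignal, hk.limUnder_eq]
  exact hS.limUnder_eq

end Convergence

end

theorem lemma2 {Ω : Type*} [MeasurableSpace Ω] (P : Measure Ω) [IsProbabilityMeasure P]
    (M : ℕ) (hM : 1 ≤ M)
    (lam η PT G d0 T1 T2 α ro : ℝ)
    (hlam : 0 < lam) (hη : 0 < η) (hPT : 0 < PT) (hG : 0 < G) (hd0 : 1 ≤ d0)
    (hT1 : 0 < T1) (hT2 : 0 < T2) (hα : 2 < α) (hro : 1 ≤ ro)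
    (N : TagEnvironment Ω M) (hN : N.IsModel lam P) :
    -- the series that defines the signal converges, and the energy integral is finite
    (∀ t ∈ Set.Icc 0 T1, ∀ᵐ ω ∂P,
      Tendsto (fun R : ℝ => N.signalWithin PT G d0 (T1 + T2) α ro R t ω) atTop
        (𝓝 (N.signal PT G d0 (T1 + T2) α ro t ω))) ∧
    (∀ᵐ ω ∂P, ∀ᵐ t ∂(volume.restrict (Set.Icc 0 T1)),
      Tendsto (fun R : ℝ => N.signalWithin PT G d0 (T1 + T2) α ro R t ω) atTop
        (𝓝 (N.signal PT G d0 (T1 + T2) α ro t ω))) ∧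
    (∀ᵐ ω ∂P, IntervalIntegrable
      (fun t => ‖N.signal PT G d0 (T1 + T2) α ro t ω‖ ^ 2) volume 0 T1) ∧
    -- the mean and the variance of the harvested energy
    MemLp (N.harvestedEnergy η PT G d0 T1 T2 α ro) 2 P ∧
    ∫ ω, N.harvestedEnergy η PT G d0 T1 T2 α ro ω ∂P =
      η * PT * T1 *
        (G * d0 ^ (-α) + Real.pi * lam * (T1 + T2) * (α / (α - 2)) * ro ^ (2 - α)) ∧
    variance (N.harvestedEnergy η PT G d0 T1 T2 α ro) P =
      (η * PT * T1) ^ 2 *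
        (2 / 3 * (2 * T1 + 3 * T2) * Real.pi * lam * α * ro ^ (2 - α) *
            (G * d0 ^ (-α) / (α - 2) + ro ^ (-α) / (α - 1)) +
          (Real.pi * lam * (α / (α - 2)) * ro ^ (2 - α)) ^ 2 *
            (1 / 6 * (3 * T1 ^ 2 + 8 * T1 * T2 + 6 * T2 ^ 2))) := by
  have hro0 : 0 < ro := by linarith
  have hα0 : 0 ≤ α := by linarith
  have hT : 0 ≤ T1 + T2 := by linarith
  have hTT : T1 ≤ T1 + T2 := by linarith
  have hX := hN.poisson
  have hlaw := hN.hasLaw_reader_marks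
  set J : Ω → (ℕ → Plane × ℝ) × ℂ × (ℕ → ℂ) := fun ω => ((fun n => N.reader n ω),
    (Complex.exp ((N.tagPhase ω : ℂ) * Complex.I), fun n => N.coefficient n ω)) with hJ
  set a : ℝ := Real.sqrt (G * d0 ^ (-α)) with ha
  have ha2 : a ^ 2 = G * d0 ^ (-α) :=
    Real.sq_sqrt (mul_nonneg hG.le (Real.rpow_nonneg (by linarith) _))
  have hpull : ∀ {p : (ℕ → Plane × ℝ) × ℂ × (ℕ → ℂ) → Prop},
      (∀ᵐ c ∂((P.map fun ω n => N.reader n ω).prod (markLaw M)), p c) → ∀ᵐ ω ∂P, p (J ω) :=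
    fun h => ae_of_ae_map hlaw.aemeasurable (by rwa [hlaw.map_eq])
  have hfin : ∀ᵐ ω ∂P, HasFinitePower (T1 + T2) T1 α ro fun n => N.reader n ω :=
    ae_of_ae_map (measurable_pi_iff.2 hX.measurable).aemeasurable
      (hX.ae_hasFinitePower hlam.le hα hro0)
  have hpt : ∀ t ∈ Set.Icc 0 T1, ∀ᵐ ω ∂P,
      Tendsto (fun R : ℝ => N.signalWithin PT G d0 (T1 + T2) α ro R t ω) atTop
        (𝓝 (N.signal PT G d0 (T1 + T2) α ro t ω)) := fun t ht => by
    filter_upwards [hfin, hpull (hX.ae_exists_tendsto_rat hM hlam.le hα hro0 ht)] with ω h1 h2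
    exact (N.tendsto_signalWithin hPT.le G d0 hro0 hα0 ht h1 h2).1
  have hae : ∀ᵐ ω ∂P, ∀ᵐ t ∂(volume.restrict (Set.Icc 0 T1)),
      Tendsto (fun R : ℝ => N.signalWithin PT G d0 (T1 + T2) α ro R t ω) atTop
        (𝓝 (N.signal PT G d0 (T1 + T2) α ro t ω)) ∧
      N.signal PT G d0 (T1 + T2) α ro t ω =
        ((Real.sqrt PT : ℝ) : ℂ) * normalizedSignal (T1 + T2) α ro a t (J ω) := by
    filter_upwards [hfin, hpull (hX.ae_ae_exists_tendsto_rat (T1 := T1) hM hlam.le hα hro0)]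
      with ω h1 h2
    filter_upwards [h2, ae_restrict_mem measurableSet_Icc] with t h3 ht
    exact N.tendsto_signalWithin hPT.le G d0 hro0 hα0 ht h1 h3
  -- the law of `J` reduces the moments of the energy to those of `signalEnergy`
  have hQm : AEMeasurable (fun ω => signalEnergy (T1 + T2) T1 α ro a (J ω)) P :=
    (measurable_signalEnergy (T1 + T2) T1 α ro a).comp_aemeasurable hlaw.aemeasurable
  have hQ1 := (hlaw.lintegral_comp (measurable_signalEnergy (T1 + T2) T1 α ro a).aemeasurable).trans
    (lintegral_signalEnergy hX hM hlam.le hα hro0 hT hT1.le a)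
  have hQ2 := (hlaw.lintegral_comp
    ((measurable_signalEnergy (T1 + T2) T1 α ro a).pow_const 2).aemeasurable).trans
    (lintegral_signalEnergy_sq hX hM hlam.le hα hro0 hT1.le hTT a)
  have hQfin : ∀ᵐ ω ∂P, signalEnergy (T1 + T2) T1 α ro a (J ω) ≠ ⊤ :=
    (ae_lt_top' hQm (by rw [hQ1]; exact ENNReal.ofReal_ne_top)).mono fun ω h => h.ne
  have hsq : ∀ᵐ ω ∂P, (fun t => ‖N.signal PT G d0 (T1 + T2) α ro t ω‖ ^ 2)
      =ᵐ[volume.restrict (Set.Icc 0 T1)]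
      fun t => PT * (signalPower (T1 + T2) α ro a t (J ω)).toReal := by
    filter_upwards [hae] with ω h
    filter_upwards [h] with t h3
    rw [h3.2, norm_mul, mul_pow, Complex.norm_real, Real.norm_eq_abs, sq_abs,
      Real.sq_sqrt hPT.le, signalPower, ENNReal.toReal_ofReal (sq_nonneg _)]
  have hint : ∀ᵐ ω ∂P, IntegrableOn
      (fun t => (signalPower (T1 + T2) α ro a t (J ω)).toReal) (Set.Icc 0 T1) := by
    filter_upwards [hQfin] with ω h
    exact integrable_toReal_of_lintegral_ne_top
      (measurable_signalPower_left (T1 + T2) α ro a (J ω)).aemeasurable h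
  have hE : N.harvestedEnergy η PT G d0 T1 T2 α ro =ᵐ[P]
      fun ω => η * PT * (signalEnergy (T1 + T2) T1 α ro a (J ω)).toReal := by
    filter_upwards [hsq] with ω h
    rw [TagEnvironment.harvestedEnergy, intervalIntegral.integral_of_le hT1.le,
      ← integral_Icc_eq_integral_Ioc, integral_congr_ae h, integral_const_mul, signalEnergy,
      integral_toReal (measurable_signalPower_left (T1 + T2) α ro a (J ω)).aemeasurable
        (.of_forall fun t => ENNReal.ofReal_lt_top)]
    ring
  have j1 := pathLossIntegral_nonneg hα hro0
  have j2 := pathLossIntegral_nonneg (β := 2 * α) (by linarith) hro0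
  have hlag1 : 0 ≤ T1 + T2 - T1 / 3 := by linarith
  have hlag2 : 0 ≤ (T1 + T2) ^ 2 - 2 / 3 * (T1 + T2) * T1 + T1 ^ 2 / 6 := by
    nlinarith [mul_pos hT1 hT2, mul_pos hT1 hT1, mul_pos hT2 hT2]
  obtain ⟨hL, hmean, hvar⟩ := memLp_integral_variance_of_lintegral hQm hE (by positivity)
    (by positivity) hQ1 hQ2
  refine ⟨hpt, hae.mono fun ω h => h.mono fun t h3 => h3.1, ?_, hL, ?_, ?_⟩
  · filter_upwards [hsq, hint] with ω h1 h2
    rw [intervalIntegrable_iff_integrableOn_Icc_of_le hT1.le]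
    exact (h2.const_mul PT).congr h1.symm
  · rw [hmean, ha2, pathLossIntegral]
    ring
  · -- the path-loss integral of exponent `2 * α` gives the term in `α - 1`
    have e : ro ^ (2 - 2 * α) = ro ^ (2 - α) * ro ^ (-α) := by
      rw [← Real.rpow_add hro0]; congr 1; ring
    have n1 : α - 2 ≠ 0 := by linarith
    have n2 : α - 1 ≠ 0 := by linarith
    have e2 : 2 * α / (2 * α - 2) = α / (α - 1) := by
      rw [show 2 * α - 2 = 2 * (α - 1) by ring, mul_div_mul_left _ _ two_ne_zero]
    rw [hvar, ha2, pathLossIntegral, pathLossIntegral, e, e2]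
    field_simp
    ring
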